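/- Theorem (Henckell's aperiodic pointlike theorem). Throughout, semigroups are nonempty unless said otherwise. A *variety* is a class of finite semigroups closed under subsemigroups, homomorphic images and finite direct products. A *relational morphism* from $S$ to $T$ assigns to each $s\in S$ a nonempty set $\rho(s)\subseteq T$ with $\rho(s)\rho(s')\subseteq\rho(ss')$; write $\rho^{-1}(t)=\{s : t\in\rho(s)\}$. For a variety $\mathbf V$ and a finite semigroup $S$, let $\mathrm{PL}_{\mathbf V}(S)$ be the set of all $X\subseteq S$ such that for every $T\in\mathbf V$ and every relational morphism $\rho$ from $S$ to $T$ there is $t\in T$ with $X\subseteq\rho^{-1}(t)$. For an element $s$ of a finite semigroup, $s^\omega$ denotes its unique idempotent power. Let $\mathbf A$ be the variety of finite semigroups satisfying $s^\omega s=s^\omega$ for all $s$ (the aperiodic ones), let $\mathbf{SL}$ be the variety of finite semilattices (commutative semigroups of idempotents), and put $\mathbf{SL}^1=\mathbf{SL}$ and $\mathbf{SL}^{k+1}=\mathbf{SL}\ast\ast\,\mathbf{SL}^k$ for $k\ge 1$. Here $\mathbf V\ast\ast\mathbf W$ is the variety generated by the two-sided semidirect products $M\bowtie N$ with $M\in\mathbf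 V$, $N\in\mathbf W$, i.e. by the semigroups on $M\times N$ with product $(m,n)(m',n')=((m n')(n m'),\,nn')$, for commuting left and right actions of $N$ on $M$ by endomorphisms. The power semigroup $2^S$ consists of all subsets of $S$ with the setwise product. A set $U\subseteq 2^S$ is *saturated* if it is closed under products, under taking subsets of its members, and under $X\mapsto X^{\omega+\ast}:=\bigcup_{n\ge0}X^\omega X^n$ (where $X^\omega X^0=X^\omega$). The *saturation* of a subset of $2^S$ is the smallest saturated set containing it. Let $S$ be a finite semigroup. Then $\mathrm{PL}_{\mathbf A}(S)$ is the saturation of the set of singletons in $2^S$. Moreover, for every generating set $A$ of $S$, $$\mathrm{PL}_{\mathbf A}(S)=\mathrm{PL}_{\mathbf{SL}^k}(S),\qquad k=(|A|-1)\,2^{\binom{|S|}{2}}+2^{|S|}-1 .$$ -/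

import Mathlib

open scoped Pointwise

universe u v

namespace Pointlike

/-! ### Powers and idempotent powers in a semigroup -/

/-- `sgPow x n` is the power `x ^ (n + 1)`; only positive powers exist in a semigroup. -/
def sgPow {S : Type u} [Semigroup S] (x : S) : ℕ → S
  | 0 => x
  | n + 1 => sgPow x n * x

theorem sgPow_mul_sgPow {S : Type u} [Semigroup S] (x : S) (m n : ℕ) :
    sgPow x m * sgPow x n = sgPow x (m + n + 1) := by
  induction n with
  | zero => rfl
  | succ n ih =>
    change sgPow x m * (sgPow x n * x) = sgPow x (m + n + 1) * x
    rw [← mul_assoc, ih]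

theorem exists_idempotent_sgPow {S : Type u} [Semigroup S] [Finite S] (x : S) :
    ∃ n : ℕ, IsIdempotentElem (sgPow x n) := by
  obtain ⟨i, j, hne, hij⟩ := Finite.exists_ne_map_eq_of_infinite (sgPow x)
  wlog hlt : i < j generalizing i j
  · exact this j i hne.symm hij.symm (by omega)
  obtain ⟨d, rfl⟩ : ∃ d, j = i + (d + 1) := ⟨j - i - 1, by omega⟩
  have step : ∀ k, i ≤ k → sgPow x (k + (d + 1)) = sgPow x k := by
    intro k hk
    induction k, hk using Nat.le_induction with
    | base => exact hij.symm
    | succ k _ ih =>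
      rw [show k + 1 + (d + 1) = (k + (d + 1)) + 1 by omega]
      change sgPow x (k + (d + 1)) * x = sgPow x k * x
      rw [ih]
  have steps : ∀ q k, i ≤ k → sgPow x (k + q * (d + 1)) = sgPow x k := by
    intro q
    induction q with
    | zero => intro k _; simp
    | succ q ih =>
      intro k hk
      rw [Nat.succ_mul, ← add_assoc, step _ (by omega), ih k hk]
  obtain ⟨n, hn⟩ : ∃ n, n + 1 = (i + 1) * (d + 1) :=
    ⟨(i + 1) * (d + 1) - 1, Nat.sub_add_cancel (Nat.mul_pos (by omega) (by omega))⟩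
  refine ⟨n, ?_⟩
  have hi : i ≤ n := by nlinarith
  change sgPow x n * sgPow x n = sgPow x n
  rw [sgPow_mul_sgPow, add_assoc, hn, steps _ _ hi]

/-- `omegaPow x` is the idempotent power `x ^ ω` of an element of a finite semigroup. -/
noncomputable def omegaPow {S : Type u} [Semigroup S] [Finite S] (x : S) : S :=
  sgPow x (exists_idempotent_sgPow x).choose

theorem sgPow_of_idempotent {S : Type u} [Semigroup S] {x : S}
    (hx : IsIdempotentElem x) (n : ℕ) : sgPow x n = x := by
  induction n with
  | zero => rfl
  | succ n ih => change sgPow x n * x = x; rw [ih]; exact hx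

theorem sgPow_sgPow {S : Type u} [Semigroup S] (x : S) (m n : ℕ) :
    sgPow (sgPow x m) n = sgPow x ((m + 1) * (n + 1) - 1) := by
  induction n with
  | zero => simp [sgPow]
  | succ n ih =>
    change sgPow (sgPow x m) n * sgPow x m = _
    rw [ih, sgPow_mul_sgPow]
    congr 1
    have h1 : 1 ≤ (m + 1) * (n + 1) := Nat.mul_pos (by omega) (by omega)
    have h2 : (m + 1) * (n + 1 + 1) = (m + 1) * (n + 1) + (m + 1) := by ring
    omega

/-- The idempotent power is unique, so `omegaPow` does not depend on any choice. -/
theorem omegaPow_eq {S : Type u} [Semigroup S] [Finite S] (x : S) {n : ℕ}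
    (hn : IsIdempotentElem (sgPow x n)) : omegaPow x = sgPow x n := by
  have hm : IsIdempotentElem (omegaPow x) := (exists_idempotent_sgPow x).choose_spec
  have h1 := sgPow_of_idempotent hm n
  have h2 := sgPow_of_idempotent hn (exists_idempotent_sgPow x).choose
  rw [omegaPow, sgPow_sgPow] at h1
  rw [sgPow_sgPow, mul_comm] at h2
  rw [omegaPow, ← h1, h2]

/-! ### Saturation in the power semigroup -/

/-- `X ^ (ω + *) = ⋃_{n ≥ 0} X ^ ω * X ^ n`, the term for `n = 0` being `X ^ ω`. -/
noncomputable def omegaStar {S : Type u} [Semigroup S] [Finite S] (X : Set S) : Set S :=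
  omegaPow X ∪ ⋃ n : ℕ, omegaPow X * sgPow X n

/-- A saturated set of subsets: a subsemigroup of the power semigroup that is closed downward
under inclusion and closed under `X ↦ X ^ (ω + *)`. -/
structure IsSaturated {S : Type u} [Semigroup S] [Finite S] (U : Set (Set S)) : Prop where
  mul_mem : ∀ X ∈ U, ∀ Y ∈ U, X * Y ∈ U
  downward : ∀ X ∈ U, ∀ Y, Y ⊆ X → Y ∈ U
  omegaStar_mem : ∀ X ∈ U, omegaStar X ∈ U

/-- The saturation of `U`: the smallest saturated set containing `U`. -/
def saturation {S : Type u} [Semigroup S] [Finite S] (U : Set (Set S)) : Set (Set S) :=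
  ⋂₀ {V | U ⊆ V ∧ IsSaturated V}

/-! ### Varieties of finite semigroups -/

/-- A class of finite semigroups. -/
abbrev SemigroupClass := ∀ (T : Type u) [Semigroup T] [Finite T], Prop

/-- A variety of finite semigroups (often called a pseudovariety): a class closed under
subsemigroups, homomorphic images and finite direct products (including the empty product).
Closure under isomorphism is included in closure under homomorphic images. -/
structure IsVariety (V : SemigroupClass.{u}) : Prop where
  sub : ∀ (T T' : Type u) [Semigroup T] [Finite T] [Semigroup T'] [Finite T'] (f : T →ₙ* T'),
    Function.Injective f → V T' → V T
  image : ∀ (T T' : Type u) [Semigroup T] [Finite T] [Semigroup T'] [Finite T'] (f : T →ₙ* T'),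
    Function.Surjective f → V T → V T'
  prod : ∀ (T T' : Type u) [Semigroup T] [Finite T] [Semigroup T'] [Finite T'],
    V T → V T' → V (T × T')
  unit : V PUnit.{u + 1}

/-- The variety generated by a class: the smallest variety containing it. -/
def generatedVariety (C : SemigroupClass.{u}) : SemigroupClass.{u} := fun T _ _ =>
  ∀ V : SemigroupClass.{u}, IsVariety V →
    (∀ (P : Type u) [Semigroup P] [Finite P], C P → V P) → V T

/-- A left and a right action of `N` on `M` by endomorphisms which commute with each other. -/
structure BiAction (M N : Type u) [Semigroup M] [Semigroup N] where
  /-- the left action `(n, m) ↦ n m` -/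
  left : N → M → M
  /-- the right action `(m, n) ↦ m n` -/
  right : M → N → M
  left_mul : ∀ n m m', left n (m * m') = left n m * left n m'
  right_mul : ∀ n m m', right (m * m') n = right m n * right m' n
  left_left : ∀ n n' m, left (n * n') m = left n (left n' m)
  right_right : ∀ n n' m, right m (n * n') = right (right m n) n'
  left_right : ∀ n n' m, right (left n m) n' = left n (right m n')

/-- The underlying set `M × N` of the two-sided semidirect product of `M` and `N`. -/
@[ext] structure TwoSided {M N : Type u} [Semigroup M] [Semigroup N] (α : BiAction M N) where
  /-- the coordinate in the semigroup acted upon -/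
  fst : M
  /-- the coordinate in the acting semigroup -/
  snd : N

/-- The product `(m, n) (m', n') = ((m n') (n m'), n n')`. -/
instance {M N : Type u} [Semigroup M] [Semigroup N] (α : BiAction M N) :
    Semigroup (TwoSided α) where
  mul p q := ⟨α.right p.fst q.snd * α.left p.snd q.fst, p.snd * q.snd⟩
  mul_assoc p q r := by
    apply TwoSided.ext
    · change α.right (α.right p.fst q.snd * α.left p.snd q.fst) r.snd *
          α.left (p.snd * q.snd) r.fst =
        α.right p.fst (q.snd * r.snd) *
          α.left p.snd (α.right q.fst r.snd * α.left q.snd r.fst)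
      rw [α.right_mul, α.left_mul, α.left_left, α.right_right, α.left_right, mul_assoc]
    · exact mul_assoc p.snd q.snd r.snd

/-- The class of the two-sided semidirect products of a member of `V` by a member of `W`. -/
def twoSidedProducts (V W : SemigroupClass.{u}) : SemigroupClass.{u} := fun P _ _ =>
  ∃ (M N : Type u) (_ : Semigroup M) (_ : Finite M) (_ : Semigroup N) (_ : Finite N)
    (α : BiAction M N), V M ∧ W N ∧ Nonempty (P ≃* TwoSided α)

/-- The two-sided semidirect product `V ** W` of varieties. -/
def doubleStar (V W : SemigroupClass.{u}) : SemigroupClass.{u} :=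
  generatedVariety (twoSidedProducts V W)

/-- The variety of finite semilattices. -/
def Semilattices : SemigroupClass.{u} := fun T _ _ =>
  (∀ x y : T, x * y = y * x) ∧ ∀ x : T, x * x = x

/-- The varieties `SL ^ k` for `k ≥ 1`, where `SL ^ (k + 1) = SL ** SL ^ k`. The value at `0`
(the class of trivial semigroups) is only a filler. -/
def SLPow : ℕ → SemigroupClass.{u}
  | 0 => fun T _ _ => Subsingleton T
  | 1 => Semilattices
  | k + 2 => doubleStar Semilattices (SLPow (k + 1))

/-- The variety of finite aperiodic semigroups. -/
def Aperiodics : SemigroupClass.{u} := fun T _ _ => ∀ s : T, omegaPow s * s = omegaPow s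

/-! ### Relational morphisms and pointlike sets -/

/-- A relational morphism from `S` to `T`. -/
structure RelMorphism (S : Type u) (T : Type v) [Semigroup S] [Semigroup T] where
  /-- the set of elements of `T` related to an element of `S` -/
  rel : S → Set T
  nonempty : ∀ s, (rel s).Nonempty
  mul_subset : ∀ s s', rel s * rel s' ⊆ rel (s * s')

/-- The inverse image of an element under a relational morphism. -/
def RelMorphism.preimage {S : Type u} {T : Type v} [Semigroup S] [Semigroup T]
    (ρ : RelMorphism S T) (t : T) : Set S := {s | t ∈ ρ.rel s}

/-- `PL V S` is the set of the `V`-pointlike subsets of `S`. Letting `T` range over the universe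
of `S` is no restriction, since a finite semigroup has isomorphic copies in every universe. -/
def PL (V : SemigroupClass.{u}) (S : Type u) [Semigroup S] : Set (Set S) :=
  {X | ∀ (T : Type u) [Semigroup T] [Finite T], V T →
    ∀ ρ : RelMorphism S T, ∃ t : T, X ⊆ ρ.preimage t}

end Pointlike

/-! The inclusion of the saturation in the family of aperiodic pointlike sets is elementary: the
pointlike sets form a saturated family (`isSaturated_PL_aperiodics`). Since the iterated products
`SLPow k` consist of aperiodic semigroups (`aperiodics_of_slPow`), every aperiodic pointlike set is
pointlike for `SLPow k`. What remains is that every set which is pointlike for `SLPow k`, with `k`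
as in the theorem, lies in the saturation (`PL_slPow_subset_saturation`).

For this, consider words over a finite alphabet up to the back-and-forth equivalence `WordEqv k`,
as for first-order sentences of bounded quantifier depth. Sending a word to the set of its
contexts `(p, x, q)`, with `p` and `q` taken up to equivalence at depth `k`, shows inductively that
the words up to equivalence at depth `k` form a semigroup in `SLPow (k + 1)`
(`exists_slPow_recognizing`). It thus suffices to find a depth at which the union of the products
of all words in a single class belongs to the saturation. This is `classProd_mem`, stated for words
whose letters are nonempty sets in the saturation and proved by induction on the size of the
subsemigroup `R` spanned by the letters, and then on the number of letters:

* For a single letter `X` a class consists of one power of `X` or of powers in the periodic range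
  of the sequence of powers, and the latter is covered by the operation `X ↦ X ^ (ω + *)`
  (`classProd_mem_of_single`).
* If `X R = R = R X` for all letters `X`, then `R` itself is in the saturation (`spanOf_mem`).
* If `X R ≠ R` for some letter `X`, cut a word into maximal powers of `X` and maximal words
  without `X`. A power of `X` followed by a word without `X` forms a block, and the sets attached to
  the blocks lie in the smaller subsemigroup `X R`. So the words without `X` are covered by the
  induction on the number of letters, and the words of blocks by the induction on the size of `R`.
  Equivalence of words entails equivalence of the words of blocks at a smaller depth
  (`WordEqv.blocks_map`, `classProd_mem_of_blocks`). The case `R X ≠ R` is its mirror image.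

The recursion for the depths that results from the last case is solved in `depth_add_le`. -/

namespace Pointlike

theorem map_sgPow {S : Type u} {T : Type v} [Semigroup S] [Semigroup T] (f : S →ₙ* T) (x : S)
    (n : ℕ) : f (sgPow x n) = sgPow (f x) n := by
  induction n with
  | zero => rfl
  | succ n ih =>
    change f (sgPow x n * x) = sgPow (f x) n * f x
    rw [map_mul, ih]

theorem omegaPow_idempotent {S : Type u} [Semigroup S] [Finite S] (x : S) :
    IsIdempotentElem (omegaPow x) :=
  (exists_idempotent_sgPow x).choose_spec

theorem exists_omegaPow_eq {S : Type u} [Semigroup S] [Finite S] (x : S) :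
    ∃ n, omegaPow x = sgPow x n :=
  ⟨_, rfl⟩

theorem map_omegaPow {S : Type u} {T : Type v} [Semigroup S] [Finite S] [Semigroup T] [Finite T]
    (f : S →ₙ* T) (x : S) : f (omegaPow x) = omegaPow (f x) := by
  obtain ⟨n, hn⟩ := exists_omegaPow_eq x
  have h := congrArg f (omegaPow_idempotent x)
  rw [hn, map_mul, map_sgPow] at h
  rw [hn, map_sgPow, omegaPow_eq (f x) h]

theorem self_mul_sgPow {S : Type u} [Semigroup S] (x : S) (n : ℕ) :
    x * sgPow x n = sgPow x n * x := by
  have h := sgPow_mul_sgPow x 0 n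
  rw [zero_add] at h
  exact h

/-! ### Semigroups in the iterated products of semilattices are aperiodic -/

theorem isVariety_aperiodics : IsVariety Aperiodics.{u} where
  sub T T' _ _ _ _ f hf h s := by
    apply hf
    rw [map_mul, map_omegaPow]
    exact h (f s)
  image T T' _ _ _ _ f hf h s := by
    obtain ⟨x, rfl⟩ := hf s
    rw [← map_omegaPow, ← map_mul, h x]
  prod T T' _ _ _ _ h h' s := by
    have h1 := map_omegaPow (⟨Prod.fst, fun _ _ => rfl⟩ : T × T' →ₙ* T) s
    have h2 := map_omegaPow (⟨Prod.snd, fun _ _ => rfl⟩ : T × T' →ₙ* T') s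
    change (omegaPow s).1 = omegaPow s.1 at h1
    change (omegaPow s).2 = omegaPow s.2 at h2
    ext
    · change (omegaPow s).1 * s.1 = (omegaPow s).1
      rw [h1, h s.1]
    · change (omegaPow s).2 * s.2 = (omegaPow s).2
      rw [h2, h' s.2]
  unit _ := rfl

/-- Let `e = s ^ ω` and `g = e * s`. Both have the same idempotent second coordinate `f`. On
the elements lying over `f`, the map `(m, f) ↦ f m f` is a homomorphism to a band, so it
takes the same value at `g` and at its power `e`, and `e * x * e` depends on that value only. -/
theorem aperiodics_twoSided {M N : Type u} [Semigroup M] [Semigroup N] [Finite N]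
    (α : BiAction M N) [Finite (TwoSided α)]
    (hi : ∀ x : M, x * x = x) (hN : Aperiodics N) : Aperiodics (TwoSided α) := by
  intro s
  set e := omegaPow s with he
  obtain ⟨n, hn⟩ := exists_omegaPow_eq s
  have hee : e * e = e := omegaPow_idempotent s
  have hsnd : e.snd = omegaPow s.snd :=
    map_omegaPow (⟨TwoSided.snd, fun _ _ => rfl⟩ : TwoSided α →ₙ* N) s
  set f := e.snd with hf
  have hff : f * f = f := congrArg TwoSided.snd hee
  have hfs : f * s.snd = f := by rw [hsnd]; exact hN s.snd
  let h : TwoSided α → M := fun x => α.left f (α.right x.fst f)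
  have hmul : ∀ x y : TwoSided α, x.snd = f → y.snd = f → h (x * y) = h x * h y := by
    intro x y hx hy
    change α.left f (α.right (α.right x.fst y.snd * α.left x.snd y.fst) f) = _
    rw [hx, hy, α.right_mul, α.left_mul, ← α.right_right, hff, α.left_right, ← α.left_left, hff]
  have hes : e * s = s * e := by rw [he, hn, self_mul_sgPow]
  have hpow : ∀ j, (e * sgPow s j).snd = f ∧ h (e * sgPow s j) = h (e * s) := by
    intro j
    induction j with
    | zero => exact ⟨hfs, rfl⟩
    | succ j ih =>
      have h1 : e * sgPow s (j + 1) = (e * sgPow s j) * (e * s) := by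
        change e * (sgPow s j * s) = _
        have h2 : sgPow s j * e = e * sgPow s j := by
          rw [he, hn, sgPow_mul_sgPow, sgPow_mul_sgPow, add_comm j n]
        rw [mul_assoc, ← mul_assoc (sgPow s j), h2, ← mul_assoc, ← mul_assoc, ← mul_assoc, hee]
      rw [h1]
      refine ⟨?_, ?_⟩
      · change (e * sgPow s j).snd * (e * s).snd = f
        rw [ih.1]
        change f * (f * s.snd) = f
        rw [hfs, hff]
      · rw [hmul _ _ ih.1 hfs, ih.2, hi]
  have hge : h (e * s) = h e := by
    rw [← (hpow n).2, ← hn, hee]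
  have hfst : ∀ x : TwoSided α, x.snd = f →
      e * x * e = ⟨α.right e.fst f * h x * α.left f e.fst, f⟩ := by
    intro x hx
    ext
    · change α.right (α.right e.fst x.snd * α.left e.snd x.fst) e.snd
        * α.left (e.snd * x.snd) e.fst = _
      rw [hx, ← hf, hff, α.right_mul, ← α.right_right, hff, α.left_right]
    · change e.snd * x.snd * e.snd = f
      rw [hx, ← hf, hff, hff]
  have h1 : e * s = e * (e * s) * e := by
    rw [← mul_assoc, hee, mul_assoc, ← hes, ← mul_assoc, hee]
  have h2 : e = e * e * e := by rw [hee, hee]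
  rw [h1, hfst _ hfs, hge, ← hfst e rfl, ← h2]

theorem aperiodics_of_slPow : ∀ (k : ℕ) (T : Type u) [Semigroup T] [Finite T],
    SLPow k T → Aperiodics T
  | 0, T, _, _, h => fun s => by
      have : Subsingleton T := h
      exact Subsingleton.elim _ _
  | 1, T, _, _, h => fun s => by
      rw [omegaPow_eq s (n := 0) (h.2 s)]
      exact h.2 s
  | k + 2, T, _, _, h => by
      refine h Aperiodics isVariety_aperiodics ?_
      rintro P _ _ ⟨M, N, _, _, _, _, α, hM, hN, ⟨φ⟩⟩
      have : Finite (TwoSided α) := Finite.of_equiv P φ.toEquiv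
      exact isVariety_aperiodics.sub P (TwoSided α) φ.toMulHom φ.injective
        (aperiodics_twoSided α hM.2 (aperiodics_of_slPow (k + 1) N hN))

/-! ### Aperiodic pointlike sets are saturated -/

theorem sgPow_subset_preimage {S : Type u} {T : Type v} [Semigroup S] [Semigroup T]
    (ρ : RelMorphism S T) {X : Set S} {t : T} (h : X ⊆ ρ.preimage t) (n : ℕ) :
    sgPow X n ⊆ ρ.preimage (sgPow t n) := by
  induction n with
  | zero => exact h
  | succ n ih =>
    rintro _ ⟨x, hx, y, hy, rfl⟩
    exact ρ.mul_subset x y ⟨_, ih hx, _, h hy, rfl⟩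

theorem isSaturated_PL_aperiodics (S : Type u) [Semigroup S] [Finite S] :
    IsSaturated (PL Aperiodics S) where
  mul_mem X hX Y hY T _ _ hT ρ := by
    obtain ⟨t, ht⟩ := hX T hT ρ
    obtain ⟨t', ht'⟩ := hY T hT ρ
    refine ⟨t * t', ?_⟩
    rintro _ ⟨x, hx, y, hy, rfl⟩
    exact ρ.mul_subset x y ⟨_, ht hx, _, ht' hy, rfl⟩
  downward X hX Y hYX T _ _ hT ρ := by
    obtain ⟨t, ht⟩ := hX T hT ρ
    exact ⟨t, hYX.trans ht⟩
  omegaStar_mem X hX T _ _ hT ρ := by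
    obtain ⟨t, ht⟩ := hX T hT ρ
    refine ⟨omegaPow t, ?_⟩
    obtain ⟨m, hm⟩ := exists_omegaPow_eq X
    obtain ⟨p, hp⟩ := exists_omegaPow_eq t
    have hω : omegaPow X ⊆ ρ.preimage (omegaPow t) := by
      -- the exponent `(m + 1) * (p + 1)` is idempotent for both `X` and `t`
      have h := sgPow_subset_preimage ρ ht ((m + 1) * (p + 1) - 1)
      rwa [← sgPow_sgPow, ← hm, sgPow_of_idempotent (omegaPow_idempotent X), mul_comm,
        ← sgPow_sgPow, ← hp, sgPow_of_idempotent (omegaPow_idempotent t)] at h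
    have htn : ∀ n, omegaPow t * sgPow t n = omegaPow t := by
      intro n
      induction n with
      | zero => exact hT t
      | succ n ih =>
        change omegaPow t * (sgPow t n * t) = _
        rw [← mul_assoc, ih, hT t]
    refine Set.union_subset hω (Set.iUnion_subset fun n => ?_)
    rintro _ ⟨x, hx, y, hy, rfl⟩
    have h : x * y ∈ ρ.preimage (omegaPow t * sgPow t n) :=
      ρ.mul_subset x y ⟨_, hω hx, _, sgPow_subset_preimage ρ ht n hy, rfl⟩
    rwa [htn n] at h

theorem saturation_subset_PL_aperiodics (S : Type u) [Semigroup S] [Finite S] :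
    saturation (Set.range fun s : S => ({s} : Set S)) ⊆ PL Aperiodics S := by
  refine Set.sInter_subset_of_mem ⟨?_, isSaturated_PL_aperiodics S⟩
  rintro _ ⟨s, rfl⟩ T _ _ - ρ
  obtain ⟨t, ht⟩ := ρ.nonempty s
  exact ⟨t, Set.singleton_subset_iff.2 ht⟩

theorem PL_anti {V W : SemigroupClass.{u}}
    (h : ∀ (T : Type u) [Semigroup T] [Finite T], V T → W T) (S : Type u) [Semigroup S] :
    PL W S ⊆ PL V S :=
  fun _ hX T _ _ hT ρ => hX T (h T hT) ρ

/-! ### The back-and-forth equivalence on words -/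

/-- Back-and-forth equivalence of words. Words are equivalent at depth `0` when they have the
same letters. They are equivalent at depth `k + 1` when each factorization `p ++ x :: q` of
one is matched by a factorization `p' ++ x :: q'` of the other, with the same letter `x`, such
that `p, p'` and `q, q'` are equivalent at depth `k`. -/
def WordEqv {A : Type u} : ℕ → List A → List A → Prop
  | 0, u, v => ∀ x, x ∈ u ↔ x ∈ v
  | k + 1, u, v =>
    (∀ p x q, u = p ++ x :: q → ∃ p' q', v = p' ++ x :: q' ∧ WordEqv k p p' ∧ WordEqv k q q') ∧
    (∀ p x q, v = p ++ x :: q → ∃ p' q', u = p' ++ x :: q' ∧ WordEqv k p p' ∧ WordEqv k q q')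

namespace WordEqv

variable {A : Type u} {k : ℕ} {u v w : List A}

theorem refl : ∀ (k : ℕ) (u : List A), WordEqv k u u
  | 0, _ => fun _ => Iff.rfl
  | k + 1, _ => ⟨fun p _ q h => ⟨p, q, h, refl k p, refl k q⟩,
      fun p _ q h => ⟨p, q, h, refl k p, refl k q⟩⟩

theorem symm : ∀ {k : ℕ} {u v : List A}, WordEqv k u v → WordEqv k v u
  | 0, _, _, h => fun x => (h x).symm
  | _ + 1, _, _, h => ⟨h.2, h.1⟩

theorem trans : ∀ {k : ℕ} {u v w : List A}, WordEqv k u v → WordEqv k v w → WordEqv k u w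
  | 0, _, _, _, h, h' => fun x => (h x).trans (h' x)
  | k + 1, u, v, w, h, h' => by
    refine ⟨fun p x q e => ?_, fun p x q e => ?_⟩
    · obtain ⟨p', q', e', h1, h2⟩ := h.1 p x q e
      obtain ⟨p'', q'', e'', h3, h4⟩ := h'.1 p' x q' e'
      exact ⟨p'', q'', e'', trans h1 h3, trans h2 h4⟩
    · obtain ⟨p', q', e', h1, h2⟩ := h'.2 p x q e
      obtain ⟨p'', q'', e'', h3, h4⟩ := h.2 p' x q' e'
      exact ⟨p'', q'', e'', trans h1 h3, trans h2 h4⟩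

theorem of_succ : ∀ {k : ℕ} {u v : List A}, WordEqv (k + 1) u v → WordEqv k u v
  | 0, u, v, h => fun x => by
    constructor
    · intro hx
      obtain ⟨p, q, rfl⟩ := List.append_of_mem hx
      obtain ⟨p', q', rfl, -⟩ := h.1 p x q rfl
      simp
    · intro hx
      obtain ⟨p, q, rfl⟩ := List.append_of_mem hx
      obtain ⟨p', q', rfl, -⟩ := h.2 p x q rfl
      simp
  | k + 1, u, v, h => by
    refine ⟨fun p x q e => ?_, fun p x q e => ?_⟩
    · obtain ⟨p', q', e', h1, h2⟩ := h.1 p x q e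
      exact ⟨p', q', e', of_succ h1, of_succ h2⟩
    · obtain ⟨p', q', e', h1, h2⟩ := h.2 p x q e
      exact ⟨p', q', e', of_succ h1, of_succ h2⟩

theorem mono {j k : ℕ} (hjk : j ≤ k) (h : WordEqv k u v) : WordEqv j u v := by
  induction hjk with
  | refl => exact h
  | step _ ih => exact ih h.of_succ

theorem mem_iff (h : WordEqv k u v) (x : A) : x ∈ u ↔ x ∈ v :=
  h.mono (Nat.zero_le k) x

theorem eq_nil_iff (h : WordEqv k u v) : u = [] ↔ v = [] := by
  simp only [List.eq_nil_iff_forall_not_mem, h.mem_iff]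

theorem reverse : ∀ {k : ℕ} {u v : List A}, WordEqv k u v → WordEqv k u.reverse v.reverse
  | 0, _, _, h => fun x => by simpa using h x
  | k + 1, u, v, h => by
    have key : ∀ {u p q : List A} {x : A}, u.reverse = p ++ x :: q →
        u = q.reverse ++ x :: p.reverse := by
      intro u p q x e
      have := congrArg List.reverse e
      simpa using this
    refine ⟨fun p x q e => ?_, fun p x q e => ?_⟩
    · obtain ⟨p', q', rfl, h1, h2⟩ := h.1 _ _ _ (key e)
      exact ⟨q'.reverse, p'.reverse, by simp, by simpa using reverse h2, by simpa using reverse h1⟩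
    · obtain ⟨p', q', rfl, h1, h2⟩ := h.2 _ _ _ (key e)
      exact ⟨q'.reverse, p'.reverse, by simp, by simpa using reverse h2, by simpa using reverse h1⟩

end WordEqv

/-! ### Words up to back-and-forth equivalence are recognized by iterated products -/

/-- The semilattice of subsets of `X` under union. -/
@[ext] structure UnionSet (X : Type u) where
  /-- the underlying set -/
  carrier : Set X

instance (X : Type u) : Semigroup (UnionSet X) where
  mul s t := ⟨s.carrier ∪ t.carrier⟩
  mul_assoc s t r := UnionSet.ext (Set.union_assoc s.carrier t.carrier r.carrier)

instance (X : Type u) [Finite X] : Finite (UnionSet X) :=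
  Finite.of_injective UnionSet.carrier fun _ _ => UnionSet.ext

theorem semilattices_unionSet (X : Type u) [Finite X] : Semilattices (UnionSet X) :=
  ⟨fun s t => UnionSet.ext (Set.union_comm s.carrier t.carrier),
    fun s => UnionSet.ext (Set.union_self s.carrier)⟩

/-- The action of `Q` on sets of contexts `(p, x, q)`: from the left on `p`, from the right
on `q`. -/
def contextAction (Q A : Type u) [Semigroup Q] : BiAction (UnionSet (Q × A × Q)) Q where
  left n s := ⟨(fun c : Q × A × Q => (n * c.1, c.2.1, c.2.2)) '' s.carrier⟩
  right s n := ⟨(fun c : Q × A × Q => (c.1, c.2.1, c.2.2 * n)) '' s.carrier⟩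
  left_mul _ s t := UnionSet.ext (Set.image_union _ s.carrier t.carrier)
  right_mul _ s t := UnionSet.ext (Set.image_union _ s.carrier t.carrier)
  left_left n n' s := by simp only [Set.image_image, mul_assoc]
  right_right n n' s := by simp only [Set.image_image, mul_assoc]
  left_right n n' s := by simp only [Set.image_image]

theorem finite_twoSided {M N : Type u} [Semigroup M] [Semigroup N] [Finite M] [Finite N]
    (α : BiAction M N) : Finite (TwoSided α) :=
  Finite.of_injective (fun x : TwoSided α => (x.fst, x.snd)) fun x y h => by
    simp only [Prod.mk.injEq] at h
    exact TwoSided.ext h.1 h.2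

/-- For the step, a word is sent to the set of its contexts `(p, x, q)`, read in the semigroup `Q` of
the previous depth, together with its own value in `Q`. The context set of `u ++ v` is the union
of that of `u` acted on by `v` and that of `v` acted on by `u`, as in the product of
`contextAction`. -/
theorem exists_slPow_recognizing (A : Type u) [Finite A] (k : ℕ) :
    ∃ (Q : Type u) (_ : Semigroup Q) (_ : Finite Q) (f : List A → Q), SLPow (k + 1) Q ∧
      (∀ u v, f (u ++ v) = f u * f v) ∧ ∀ u v, f u = f v → WordEqv k u v := by
  induction k with
  | zero =>
    refine ⟨UnionSet A, inferInstance, inferInstance, fun w => ⟨{x : A | x ∈ w}⟩,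
      semilattices_unionSet A, fun u v => ?_, fun u v h x => ?_⟩
    · exact UnionSet.ext (Set.ext fun x => List.mem_append)
    · exact Set.ext_iff.1 (congrArg UnionSet.carrier h) x
  | succ k ih =>
    obtain ⟨Q, _, _, f, hQ, hf, hfe⟩ := ih
    let α := contextAction Q A
    have hfin := finite_twoSided α
    let ctx : List A → Set (Q × A × Q) := fun w =>
      {c | ∃ p x q, w = p ++ x :: q ∧ (f p, x, f q) = c}
    have hctx : ∀ u v, ctx (u ++ v) =
        (fun c : Q × A × Q => (c.1, c.2.1, c.2.2 * f v)) '' ctx u ∪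
          (fun c : Q × A × Q => (f u * c.1, c.2.1, c.2.2)) '' ctx v := by
      intro u v
      ext c
      constructor
      · rintro ⟨p, x, q, e, rfl⟩
        obtain ⟨a', rfl, e2⟩ | ⟨b', rfl, e2⟩ := List.append_eq_append_iff.1 e
        · exact Or.inr ⟨_, ⟨a', x, q, e2, rfl⟩, by simp only [hf]⟩
        · cases b' with
          | nil => exact Or.inr ⟨_, ⟨[], x, q, e2.symm, rfl⟩, by simp [← hf]⟩
          | cons y b' =>
            simp only [List.cons_append, List.cons.injEq] at e2
            obtain ⟨rfl, rfl⟩ := e2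
            exact Or.inl ⟨_, ⟨p, x, b', rfl, rfl⟩, by simp only [hf]⟩
      · rintro (⟨_, ⟨p, x, q, rfl, rfl⟩, rfl⟩ | ⟨_, ⟨p, x, q, rfl, rfl⟩, rfl⟩)
        · exact ⟨p, x, q ++ v, by simp, by simp only [hf]⟩
        · exact ⟨u ++ p, x, q, by simp, by simp only [hf]⟩
    refine ⟨TwoSided α, inferInstance, hfin, fun w => ⟨⟨ctx w⟩, f w⟩, ?_, fun u v => ?_,
      fun u v h => ?_⟩
    · intro V _ hV
      exact hV _ ⟨_, Q, inferInstance, inferInstance, inferInstance, inferInstance, α,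
        semilattices_unionSet _, hQ, ⟨MulEquiv.refl _⟩⟩
    · exact TwoSided.ext (UnionSet.ext (hctx u v)) (hf u v)
    · have h1 := Set.ext_iff.1 (congrArg (fun z => z.fst.carrier) h)
      refine ⟨fun p x q e => ?_, fun p x q e => ?_⟩
      · obtain ⟨p', x', q', e', he⟩ := (h1 (f p, x, f q)).1 ⟨p, x, q, e, rfl⟩
        simp only [Prod.mk.injEq] at he
        obtain ⟨h2, rfl, h3⟩ := he
        exact ⟨p', q', e', hfe _ _ h2.symm, hfe _ _ h3.symm⟩
      · obtain ⟨p', x', q', e', he⟩ := (h1 (f p, x, f q)).2 ⟨p, x, q, e, rfl⟩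
        simp only [Prod.mk.injEq] at he
        obtain ⟨h2, rfl, h3⟩ := he
        exact ⟨p', q', e', hfe _ _ h2.symm, hfe _ _ h3.symm⟩
/-! ### Decomposing a word into blocks around a letter -/

/-- How a block decomposition changes when a letter is put in front of the word. -/
def blockCons {A : Type u} [DecidableEq A] (a x : A) :
    List A × List (List A × List A) × List A → List A × List (List A × List A) × List A
  | (c₀, L, b) =>
    if x = a then
      match c₀, L with
      | y :: c, L => ([], ([], y :: c) :: L, b)
      | [], [] => ([], [], a :: b)
      | [], (p, c) :: L => ([], (a :: p, c) :: L, b)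
    else (x :: c₀, L, b)

/-- The block decomposition of a word with respect to a letter `a`. The value `(c₀, L, b)` stands
for the factorization `c₀ (p₁ a c₁) ⋯ (pₙ a cₙ) b` with `L = [(p₁, c₁), …, (pₙ, cₙ)]`, in which
`b` and all `pᵢ` are powers of `a`, while `c₀` and all `cᵢ` avoid `a`, and the `cᵢ` are
nonempty. The block `pᵢ a cᵢ` is thus a maximal power of `a` followed by a maximal nonempty word
avoiding `a`. -/
def blocks {A : Type u} [DecidableEq A] (a : A) : List A → List A × List (List A × List A) × List A
  | [] => ([], [], [])
  | x :: w => blockCons a x (blocks a w)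

/-- The word with a given block decomposition. -/
def unblock {A : Type u} (a : A) (d : List A × List (List A × List A) × List A) : List A :=
  d.1 ++ (d.2.1.flatMap (fun p => p.1 ++ a :: p.2) ++ d.2.2)

/-- The conditions on the factors of a block decomposition with respect to `a`. -/
structure IsBlockDecomposition {A : Type u} (a : A)
    (d : List A × List (List A × List A) × List A) : Prop where
  head : a ∉ d.1
  left : ∀ p ∈ d.2.1, ∀ x ∈ p.1, x = a
  right : ∀ p ∈ d.2.1, a ∉ p.2
  right_ne_nil : ∀ p ∈ d.2.1, p.2 ≠ []
  tail : ∀ x ∈ d.2.2, x = a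

section Blocks

variable {A : Type u} [DecidableEq A] {a : A}

theorem unblock_blocks (w : List A) : unblock a (blocks a w) = w := by
  induction w with
  | nil => rfl
  | cons x w ih =>
    rw [blocks]
    generalize blocks a w = d at ih ⊢
    subst ih
    obtain ⟨c₀, L, b⟩ := d
    by_cases hx : x = a
    · subst hx
      rcases c₀ with _ | ⟨y, c⟩
      · rcases L with _ | ⟨⟨p, c⟩, L⟩ <;> simp [blockCons, unblock]
      · simp [blockCons, unblock]
    · simp [blockCons, unblock, hx]

theorem isBlockDecomposition_blocks (w : List A) : IsBlockDecomposition a (blocks a w) := by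
  induction w with
  | nil => constructor <;> simp [blocks]
  | cons x w ih =>
    rw [blocks]
    generalize blocks a w = d at ih ⊢
    obtain ⟨c₀, L, b⟩ := d
    obtain ⟨h1, h2, h3, h4, h5⟩ := ih
    by_cases hx : x = a
    · subst hx
      rcases c₀ with _ | ⟨y, c⟩
      · rcases L with _ | ⟨⟨p, c⟩, L⟩ <;> constructor <;> simp_all [blockCons] <;> tauto
      · constructor <;> simp_all [blockCons] <;> tauto
    · constructor <;> simp_all [blockCons, Ne.symm hx] <;> tauto

theorem blocks_append_of_notMem {c : List A} (hc : a ∉ c) (w : List A) :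
    blocks a (c ++ w) = (c ++ (blocks a w).1, (blocks a w).2) := by
  induction c with
  | nil => rfl
  | cons x c ih =>
    simp only [List.mem_cons, not_or] at hc
    simp [blocks, ih hc.2, blockCons, Ne.symm hc.1]

theorem blocks_of_forall_eq {b : List A} (hb : ∀ x ∈ b, x = a) : blocks a b = ([], [], b) := by
  induction b with
  | nil => rfl
  | cons x b ih =>
    simp only [List.mem_cons, forall_eq_or_imp] at hb
    simp [blocks, ih hb.2, blockCons, hb.1]

theorem blocks_append_cons (u : List A) {v : List A} (hv : (blocks a v).1 ≠ []) :
    blocks a (u ++ a :: v) = ((blocks a u).1,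
      (blocks a u).2.1 ++ ((blocks a u).2.2, (blocks a v).1) :: (blocks a v).2.1,
      (blocks a v).2.2) := by
  induction u with
  | nil =>
    rw [List.nil_append, show blocks a (a :: v) = blockCons a a (blocks a v) from rfl]
    generalize blocks a v = d at hv ⊢
    obtain ⟨_ | ⟨y, c⟩, L, b⟩ := d
    · exact absurd rfl hv
    · simp [blockCons, blocks]
  | cons x u ih =>
    rw [List.cons_append, blocks, ih, blocks]
    generalize blocks a u = d
    obtain ⟨c₀, L, b⟩ := d
    by_cases hx : x = a
    · subst hx
      rcases c₀ with _ | ⟨y, c⟩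
      · rcases L with _ | ⟨⟨p, c⟩, L⟩ <;> simp [blockCons]
      · simp [blockCons]
    · simp [blockCons, hx]

theorem blocks_unblock {c₀ b : List A} {L : List (List A × List A)}
    (h : IsBlockDecomposition a (c₀, L, b)) : blocks a (unblock a (c₀, L, b)) = (c₀, L, b) := by
  induction L generalizing c₀ with
  | nil =>
    have := blocks_append_of_notMem h.head b
    rw [blocks_of_forall_eq h.tail, List.append_nil] at this
    simpa [unblock] using this
  | cons p L ih =>
    obtain ⟨p, c⟩ := p
    have hv := ih (c₀ := c) ⟨h.right (p, c) (by simp), fun q hq => h.left q (by simp_all),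
      fun q hq => h.right q (by simp_all), fun q hq => h.right_ne_nil q (by simp_all), h.tail⟩
    have hu := blocks_append_of_notMem h.head p
    rw [blocks_of_forall_eq (h.left (p, c) (by simp)), List.append_nil] at hu
    have hc : c ≠ [] := h.right_ne_nil (p, c) (by simp)
    have := blocks_append_cons (a := a) (c₀ ++ p) (v := unblock a (c, L, b)) (by rw [hv]; exact hc)
    rw [hv, hu] at this
    simpa [unblock] using this

/-- Cutting a word at the last `a` of a block cuts its block decomposition accordingly. -/
theorem exists_split_of_blocks {w p c : List A} {L₁ L₂ : List (List A × List A)}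
    (h : (blocks a w).2.1 = L₁ ++ (p, c) :: L₂) :
    ∃ u v, w = u ++ a :: v ∧ (blocks a u).2.1 = L₁ ∧ (blocks a u).2.2 = p ∧
      (blocks a v).1 = c ∧ (blocks a v).2.1 = L₂ ∧ c ≠ [] := by
  have hw := unblock_blocks (a := a) w
  have hd := isBlockDecomposition_blocks (a := a) w
  generalize blocks a w = d at hw hd h
  obtain ⟨c₀, L, b⟩ := d
  dsimp only at h
  subst h
  have hu : IsBlockDecomposition a (c₀, L₁, p) :=
    ⟨hd.head, fun q hq => hd.left q (by simp_all), fun q hq => hd.right q (by simp_all),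
      fun q hq => hd.right_ne_nil q (by simp_all), hd.left (p, c) (by simp)⟩
  have hv : IsBlockDecomposition a (c, L₂, b) :=
    ⟨hd.right (p, c) (by simp), fun q hq => hd.left q (by simp_all),
      fun q hq => hd.right q (by simp_all), fun q hq => hd.right_ne_nil q (by simp_all), hd.tail⟩
  refine ⟨unblock a (c₀, L₁, p), unblock a (c, L₂, b), ?_, ?_, ?_, ?_, ?_,
    hd.right_ne_nil (p, c) (by simp)⟩
  · rw [← hw]; simp [unblock]
  · rw [blocks_unblock hu]
  · rw [blocks_unblock hu]
  · rw [blocks_unblock hv]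
  · rw [blocks_unblock hv]

theorem blocks_tail_append {x : A} (hx : x ≠ a) (p : List A) {s : List A}
    (hs : ∀ y ∈ s, y = a) : (blocks a (p ++ x :: s)).2.2 = s := by
  have key : (blocks a (p ++ x :: s)).2.2 = s ∧
      ((blocks a (p ++ x :: s)).1 = [] → (blocks a (p ++ x :: s)).2.1 ≠ []) := by
    induction p with
    | nil => simp [blocks, blocks_of_forall_eq hs, blockCons, hx]
    | cons y p ih =>
      rw [List.cons_append, blocks]
      generalize blocks a (p ++ x :: s) = d at ih ⊢
      obtain ⟨c₀, L, b⟩ := d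
      by_cases hy : y = a
      · subst hy
        rcases c₀ with _ | ⟨z, c⟩
        · rcases L with _ | ⟨⟨p, c⟩, L⟩ <;> simp_all [blockCons]
        · simp_all [blockCons]
      · simp_all [blockCons]
  exact key.1

theorem exists_last_ne (a : A) (w : List A) : (∀ x ∈ w, x = a) ∨
    ∃ p x s, w = p ++ x :: s ∧ x ≠ a ∧ ∀ y ∈ s, y = a := by
  induction w with
  | nil => simp
  | cons y w ih =>
    obtain h | ⟨p, x, s, rfl, hx, hs⟩ := ih
    · by_cases hy : y = a
      · exact Or.inl (List.forall_mem_cons.2 ⟨hy, h⟩)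
      · exact Or.inr ⟨[], y, w, rfl, hy, h⟩
    · exact Or.inr ⟨y :: p, x, s, rfl, hx, hs⟩

theorem WordEqv.blocks_head {k : ℕ} {v v' : List A} (h : WordEqv (k + 1) v v') :
    WordEqv k (blocks a v).1 (blocks a v').1 := by
  have key : ∀ {c : List A}, a ∉ c → ∀ q, (blocks a (c ++ a :: q)).1 = c := by
    intro c hc q
    have h1 := (isBlockDecomposition_blocks (a := a) (a :: q)).head
    have h2 := unblock_blocks (a := a) (a :: q)
    rw [blocks_append_of_notMem hc]
    rcases hd : (blocks a (a :: q)).1 with _ | ⟨y, d⟩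
    · simp
    · rw [hd] at h1
      simp only [unblock, hd, List.cons_append, List.cons.injEq] at h2
      simp [h2.1] at h1
  have key' : ∀ {c : List A}, a ∉ c → (blocks a c).1 = c := by
    intro c hc
    have := blocks_append_of_notMem hc []
    rw [List.append_nil] at this
    rw [this]; simp [blocks]
  by_cases ha : a ∈ v
  · obtain ⟨c, q, rfl, hc⟩ := List.eq_append_cons_of_mem ha
    obtain ⟨c', q', rfl, h1, -⟩ := h.1 _ _ _ rfl
    rw [key hc, key (fun h2 => hc ((h1.mem_iff a).2 h2))]
    exact h1
  · rw [key' ha, key' (fun h2 => ha ((h.mem_iff a).2 h2))]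
    exact h.of_succ

theorem WordEqv.blocks_tail {k : ℕ} {u u' : List A} (h : WordEqv (k + 1) u u') :
    WordEqv k (blocks a u).2.2 (blocks a u').2.2 := by
  obtain hu | ⟨p, x, s, rfl, hx, hs⟩ := exists_last_ne a u
  · rw [blocks_of_forall_eq hu, blocks_of_forall_eq fun x hx => hu x ((h.mem_iff x).2 hx)]
    exact h.of_succ
  · obtain ⟨p', s', rfl, -, h2⟩ := h.1 _ _ _ rfl
    rw [blocks_tail_append hx _ hs,
      blocks_tail_append hx _ fun y hy => hs y ((h2.mem_iff y).2 hy)]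
    exact h2

/-- A block is marked by the position of its last `a`. The factors of the block next to that
position are found at depth `k + 1`, the position itself costs one more level, and after that
each level of equivalence of the words of blocks costs one level. -/
theorem WordEqv.blocks_map {B : Type u} {g : List A × List A → B} {k : ℕ}
    (hg : ∀ p p' c c', WordEqv k p p' → WordEqv k c c' → g (p, c) = g (p', c')) (j : ℕ) :
    ∀ {w w' : List A}, WordEqv (k + 2 + j) w w' →
      WordEqv j ((blocks a w).2.1.map g) ((blocks a w').2.1.map g) := by
  have half : ∀ {i : ℕ} {w w' : List A}, WordEqv (k + 2 + i) w w' →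
      ∀ P y Q, (blocks a w).2.1.map g = P ++ y :: Q →
      ∃ u v u' v', w' = u' ++ a :: v' ∧ WordEqv (k + 1 + i) u u' ∧ WordEqv (k + 1 + i) v v' ∧
        P = (blocks a u).2.1.map g ∧ Q = (blocks a v).2.1.map g ∧
        (blocks a w').2.1.map g =
          (blocks a u').2.1.map g ++ y :: (blocks a v').2.1.map g := by
    intro i w w' h P y Q e
    obtain ⟨L₁, L', hL, rfl, e₂⟩ := List.map_eq_append_iff.1 e
    obtain ⟨⟨p, c⟩, L₂, rfl, rfl, rfl⟩ := List.map_eq_cons_iff.1 e₂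
    obtain ⟨u, v, rfl, rfl, rfl, rfl, rfl, hc⟩ := exists_split_of_blocks hL
    rw [show k + 2 + i = (k + 1 + i) + 1 by omega] at h
    obtain ⟨u', v', rfl, h1, h2⟩ := h.1 _ _ _ rfl
    have hp := (h1.mono (j := k + 1) (by omega)).blocks_tail (a := a)
    have hc' := (h2.mono (j := k + 1) (by omega)).blocks_head (a := a)
    have hne : (blocks a v').1 ≠ [] := fun h3 => hc (hc'.eq_nil_iff.2 h3)
    refine ⟨u, v, u', v', rfl, h1, h2, rfl, rfl, ?_⟩
    rw [blocks_append_cons u' hne]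
    simp [hg _ _ _ _ hp hc']
  induction j with
  | zero =>
    have half0 : ∀ {w w' : List A}, WordEqv (k + 2 + 0) w w' →
        ∀ y ∈ (blocks a w).2.1.map g, y ∈ (blocks a w').2.1.map g := by
      intro w w' h y hy
      obtain ⟨P, Q, e⟩ := List.append_of_mem hy
      obtain ⟨u, v, u', v', -, -, -, -, -, e'⟩ := half h P y Q e
      rw [e']
      simp
    intro w w' h y
    exact ⟨half0 h y, half0 h.symm y⟩
  | succ j ih =>
    have step : ∀ {w w' : List A}, WordEqv (k + 2 + (j + 1)) w w' → ∀ P y Q,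
        (blocks a w).2.1.map g = P ++ y :: Q → ∃ P' Q',
          (blocks a w').2.1.map g = P' ++ y :: Q' ∧ WordEqv j P P' ∧ WordEqv j Q Q' := by
      intro w w' h P y Q e
      obtain ⟨u, v, u', v', -, h1, h2, rfl, rfl, e'⟩ := half h P y Q e
      rw [show k + 1 + (j + 1) = k + 2 + j by omega] at h1 h2
      exact ⟨_, _, e', ih h1, ih h2⟩
    intro w w' h
    exact ⟨step h, step h.symm⟩

end Blocks

/-- Powers of a letter with at most `k` factors are determined at depth `k`. -/
theorem WordEqv.replicate {A : Type u} {x : A} {k i j : ℕ}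
    (h : WordEqv k (List.replicate i x) (List.replicate j x)) (hij : i < j) : k < i := by
  induction k generalizing i j with
  | zero =>
    have := (h x).2 (by simp; omega)
    simp at this
    omega
  | succ k ih =>
    obtain ⟨j, rfl⟩ : ∃ j', j = j' + 1 := ⟨j - 1, by omega⟩
    obtain ⟨p, q, e, h1, h2⟩ := h.2 (List.replicate j x) x [] (by simp [List.replicate_succ'])
    rw [h2.eq_nil_iff.1 rfl] at e
    obtain ⟨i, rfl⟩ : ∃ i', i = i' + 1 := by
      rcases i with _ | i
      · simp at e
      · exact ⟨i, rfl⟩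
    rw [List.replicate_succ'] at e
    have hp := (List.append_inj' e rfl).1
    rw [← hp] at h1
    have := ih h1.symm (by omega)
    omega
/-! ### Families of sets closed under the saturation operations -/

/-- The closure properties of a saturated family of subsets of a monoid, with `X ^ (ω + *)` in the
form `⋃_{i ≥ N} X ^ i`, where `N` is any positive exponent at which the powers of `X` have become
periodic. The family need not contain `{1}`. -/
structure IsClosedFamily {M : Type u} [Monoid M] (U : Set (Set M)) : Prop where
  mul_mem : ∀ X ∈ U, ∀ Y ∈ U, X * Y ∈ U
  downward : ∀ X ∈ U, ∀ Y, Y ⊆ X → Y ∈ U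
  tail_mem : ∀ X ∈ U, ∀ N p, 0 < N → 0 < p → X ^ N = X ^ (N + p) → {x | ∃ i, N ≤ i ∧ x ∈ X ^ i} ∈ U

/-- The union of the products `w'.prod` over all words `w'` equivalent to `w` at depth `k`. -/
def classProd {M : Type u} [Monoid M] (k : ℕ) (w : List (Set M)) : Set M :=
  {x | ∃ w', WordEqv k w' w ∧ x ∈ w'.prod}

/-- The subsemigroup generated by the members of the sets in `C`. -/
def spanOf {M : Type u} [Monoid M] (C : Finset (Set M)) : Set M :=
  {x | ∃ w : List (Set M), w ≠ [] ∧ (∀ X ∈ w, X ∈ C) ∧ x ∈ w.prod}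

theorem ncard_nonempty_subsets_le {M : Type u} [Finite M] {R : Set M} {n : ℕ} (hR : R.ncard ≤ n) :
    {Y : Set M | Y ⊆ R ∧ Y.Nonempty}.ncard ≤ 2 ^ n - 1 := by
  have h : {Y : Set M | Y ⊆ R ∧ Y.Nonempty} = 𝒫 R \ {∅} := by
    ext Y
    simp [Set.nonempty_iff_ne_empty]
  rw [h, Set.ncard_sdiff_singleton_of_mem (by simp), Set.ncard_powerset R (Set.toFinite R)]
  exact Nat.sub_le_sub_right (Nat.pow_le_pow_right (by omega) hR) 1

section Families

variable {M : Type u} [Monoid M] {U : Set (Set M)} {C : Finset (Set M)} {k : ℕ}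

theorem classProd_congr {w w' : List (Set M)} (h : WordEqv k w w') :
    classProd k w = classProd k w' :=
  Set.ext fun _ => ⟨fun ⟨v, hv, hx⟩ => ⟨v, hv.trans h, hx⟩,
    fun ⟨v, hv, hx⟩ => ⟨v, hv.trans h.symm, hx⟩⟩

theorem classProd_nil : classProd k ([] : List (Set M)) = 1 := by
  ext x
  constructor
  · rintro ⟨w, hw, hx⟩
    rw [hw.eq_nil_iff.2 rfl] at hx
    exact hx
  · exact fun hx => ⟨[], WordEqv.refl k [], hx⟩

theorem prod_subset_classProd (k : ℕ) (w : List (Set M)) : w.prod ⊆ classProd k w :=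
  fun _ hx => ⟨w, WordEqv.refl k w, hx⟩

theorem classProd_anti {j : ℕ} (hjk : j ≤ k) (w : List (Set M)) :
    classProd k w ⊆ classProd j w :=
  fun _ ⟨w', hw', hx⟩ => ⟨w', hw'.mono hjk, hx⟩

theorem prod_subset_spanOf {w : List (Set M)} (hw : w ≠ []) (hC : ∀ X ∈ w, X ∈ C) :
    w.prod ⊆ spanOf C :=
  fun _ hx => ⟨w, hw, hC, hx⟩

theorem classProd_subset_spanOf {w : List (Set M)} (hw : w ≠ []) (hC : ∀ X ∈ w, X ∈ C) :
    classProd k w ⊆ spanOf C := fun _ ⟨_, hw', hx⟩ =>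
  prod_subset_spanOf (fun h => hw (hw'.eq_nil_iff.1 h)) (fun X hX => hC X ((hw'.mem_iff X).1 hX)) hx

theorem spanOf_mono {C' : Finset (Set M)} (h : C ⊆ C') : spanOf C ⊆ spanOf C' :=
  fun _ ⟨w, hw, hC, hx⟩ => ⟨w, hw, fun X hX => h (hC X hX), hx⟩

theorem prod_subset_of_forall {R : Set M} (hR : R * R ⊆ R) {w : List (Set M)} (hw : w ≠ [])
    (h : ∀ X ∈ w, X ⊆ R) : w.prod ⊆ R := by
  induction w with
  | nil => exact absurd rfl hw
  | cons X w ih =>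
    rcases eq_or_ne w [] with rfl | hne
    · simpa using h
    · rw [List.prod_cons]
      exact (Set.mul_subset_mul (h X (by simp)) (ih hne fun Y hY => h Y (by simp [hY]))).trans hR

theorem spanOf_subset {R : Set M} (hR : R * R ⊆ R) (h : ∀ X ∈ C, X ⊆ R) : spanOf C ⊆ R :=
  fun _ ⟨_, hw, hC, hx⟩ => prod_subset_of_forall hR hw (fun X hX => h X (hC X hX)) hx

theorem spanOf_mul_subset (C : Finset (Set M)) : spanOf C * spanOf C ⊆ spanOf C := by
  rintro _ ⟨x, ⟨w, hw, hC, hx⟩, y, ⟨w', hw', hC', hy⟩, rfl⟩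
  refine ⟨w ++ w', by simp [hw], fun X hX => ?_, ?_⟩
  · exact (List.mem_append.1 hX).elim (hC X) (hC' X)
  · rw [List.prod_append]
    exact Set.mul_mem_mul hx hy

theorem subset_spanOf {X : Set M} (hX : X ∈ C) : X ⊆ spanOf C := by
  have := prod_subset_spanOf (C := C) (w := [X]) (by simp) (by simpa using hX)
  simpa using this

theorem prod_nonempty {w : List (Set M)} (h : ∀ X ∈ w, X.Nonempty) : w.prod.Nonempty := by
  induction w with
  | nil => exact Set.one_nonempty
  | cons X w ih =>
    rw [List.prod_cons]
    exact (h X (by simp)).mul (ih fun Y hY => h Y (by simp [hY]))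

theorem IsClosedFamily.prod_mem (hU : IsClosedFamily U) {w : List (Set M)} (hw : w ≠ [])
    (h : ∀ X ∈ w, X ∈ U) : w.prod ∈ U := by
  induction w with
  | nil => exact absurd rfl hw
  | cons X w ih =>
    rcases eq_or_ne w [] with rfl | hne
    · simpa using h
    · rw [List.prod_cons]
      exact hU.mul_mem _ (h X (by simp)) _ (ih hne fun Y hY => h Y (by simp [hY]))

/-! ### Words in a single letter -/

/-- The first `2 ^ n` powers of `X` are nonempty subsets of a set of size `n`, so two of them
agree. Hence the powers of `X` are periodic from the exponent `2 ^ n - 1` on, and words with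
fewer letters are determined up to equality at depth `k`. -/
theorem classProd_mem_of_single [Finite M] (hU : IsClosedFamily U) {X R : Set M} {n : ℕ}
    (hXU : X ∈ U) (hX : X.Nonempty) (hXR : X ⊆ R) (hR : R * R ⊆ R) (hn : R.ncard ≤ n)
    (hk : 2 ^ n - 1 ≤ k + 1) {w : List (Set M)} (hw : w ≠ []) (hwX : ∀ Y ∈ w, Y = X) :
    classProd k w ∈ U := by
  obtain ⟨i, rfl⟩ : ∃ i, w = List.replicate i X := ⟨_, List.eq_replicate_of_mem hwX⟩
  have hi : 0 < i := by
    rcases i with _ | i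
    · simp at hw
    · omega
  have hpow : ∀ j, 0 < j → X ^ j ⊆ R ∧ (X ^ j).Nonempty := by
    intro j hj
    refine ⟨?_, hX.pow⟩
    rw [← List.prod_replicate]
    refine prod_subset_of_forall hR (by simp; omega) fun Y hY => ?_
    rw [List.eq_of_mem_replicate hY]
    exact hXR
  have hsub : ∀ x ∈ classProd k (List.replicate i X), ∃ j, 0 < j ∧ x ∈ X ^ j ∧
      (j = i ∨ k + 1 ≤ j ∧ k + 1 ≤ i) := by
    rintro x ⟨w', hw', hx⟩
    obtain ⟨j, rfl⟩ : ∃ j, w' = List.replicate j X :=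
      ⟨_, List.eq_replicate_of_mem fun Y hY => hwX Y ((hw'.mem_iff Y).1 hY)⟩
    rw [List.prod_replicate] at hx
    have hj : 0 < j := by
      rcases j with _ | j
      · exact absurd (hw'.eq_nil_iff.1 rfl) hw
      · omega
    refine ⟨j, hj, hx, ?_⟩
    rcases lt_trichotomy i j with h | h | h
    · have := hw'.symm.replicate h
      omega
    · omega
    · have := hw'.replicate h
      omega
  by_cases hik : k + 1 ≤ i
  · obtain ⟨p, hp, q, hq, hne, hpq⟩ := Set.exists_ne_map_eq_of_ncard_lt_of_maps_to
      (s := Set.Icc 1 (2 ^ n)) (t := {Y : Set M | Y ⊆ R ∧ Y.Nonempty}) (f := fun j => X ^ j)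
      (by
        have h1 := ncard_nonempty_subsets_le hn
        have h2 : 0 < 2 ^ n := by positivity
        rw [← Finset.coe_Icc, Set.ncard_coe_finset, Nat.card_Icc]
        omega)
      (fun j hj => hpow j hj.1) (Set.toFinite _)
    wlog hlt : p < q generalizing p q
    · exact this q hq p hp hne.symm hpq.symm (by omega)
    have hper : X ^ (k + 1) = X ^ (k + 1 + (q - p)) := by
      have h1 : p ≤ k + 1 := by have := hq.2; omega
      rw [show k + 1 = p + (k + 1 - p) by omega, pow_add]
      change X ^ p = X ^ q at hpq
      rw [hpq, ← pow_add]
      congr 1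
      omega
    refine hU.downward _ (hU.tail_mem X hXU (k + 1) (q - p) (by omega) (by omega) hper) _ ?_
    intro x hx
    obtain ⟨j, -, hxj, h⟩ := hsub x hx
    exact ⟨j, by omega, hxj⟩
  · have hXi : X ^ i ∈ U := by
      rw [← List.prod_replicate]
      refine hU.prod_mem hw fun Y hY => ?_
      rw [hwX Y hY]
      exact hXU
    refine hU.downward _ hXi _ fun x hx => ?_
    obtain ⟨j, -, hxj, h⟩ := hsub x hx
    obtain rfl : j = i := by omega
    exact hxj

/-! ### Letters acting surjectively -/

theorem sgPow_eq_pow {P : Type u} [Monoid P] (x : P) (n : ℕ) : sgPow x n = x ^ (n + 1) := by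
  induction n with
  | zero => simp [sgPow]
  | succ n ih =>
    change sgPow x n * x = _
    rw [ih, ← pow_succ]

/-- Let `V` be the semigroup of all products of letters and `R` the union of its members. For an
idempotent `E ∈ V` with `E V E` of minimal size, `E V E` is a group, so that `Z ^ (ω + *)` contains
both `E` and `Z` for every `Z ∈ E V E`. The product of these sets contains every member of `E V E`,
hence contains `E R E = R`. -/
theorem spanOf_mem [Finite M] (hU : IsClosedFamily U) (hCU : ∀ X ∈ C, X ∈ U) (hC : C.Nonempty)
    (hl : ∀ X ∈ C, X * spanOf C = spanOf C) (hr : ∀ X ∈ C, spanOf C * X = spanOf C) :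
    spanOf C ∈ U := by
  let V : Set (Set M) := {Y | ∃ w : List (Set M), w ≠ [] ∧ (∀ X ∈ w, X ∈ C) ∧ Y = w.prod}
  have hVmul : ∀ Y ∈ V, ∀ Z ∈ V, Y * Z ∈ V := by
    rintro _ ⟨w, hw, hwC, rfl⟩ _ ⟨w', hw', hwC', rfl⟩
    refine ⟨w ++ w', by simp [hw], fun X hX => ?_, List.prod_append.symm⟩
    exact (List.mem_append.1 hX).elim (hwC X) (hwC' X)
  have hVU : ∀ Y ∈ V, Y ∈ U := by
    rintro _ ⟨w, hw, hwC, rfl⟩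
    exact hU.prod_mem hw fun X hX => hCU X (hwC X hX)
  have hVl : ∀ Y ∈ V, Y * spanOf C = spanOf C := by
    rintro _ ⟨w, -, hwC, rfl⟩
    induction w with
    | nil => simp
    | cons X w ih =>
      rw [List.prod_cons, mul_assoc, ih fun Z hZ => hwC Z (by simp [hZ]), hl X (hwC X (by simp))]
  have hVr : ∀ Y ∈ V, spanOf C * Y = spanOf C := by
    rintro _ ⟨w, -, hwC, rfl⟩
    induction w with
    | nil => simp
    | cons X w ih =>
      rw [List.prod_cons, ← mul_assoc, hr X (hwC X (by simp)), ih fun Z hZ => hwC Z (by simp [hZ])]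
  have hVpow : ∀ Y ∈ V, ∀ n, Y ^ (n + 1) ∈ V := by
    intro Y hY n
    induction n with
    | zero => simpa using hY
    | succ n ih => rw [pow_succ]; exact hVmul _ ih _ hY
  have hVidem : ∀ Y : Set M, ∃ n, Y ^ (n + 1) * Y ^ (n + 1) = Y ^ (n + 1) := by
    intro Y
    obtain ⟨n, hn⟩ := exists_idempotent_sgPow Y
    rw [sgPow_eq_pow] at hn
    exact ⟨n, hn⟩
  let corner : Set M → Set (Set M) := fun E => {Z | ∃ Y ∈ V, Z = E * Y * E}
  obtain ⟨E, ⟨hEV, hEE⟩, hmin⟩ := Set.exists_min_image {E | E ∈ V ∧ E * E = E}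
    (fun E => (corner E).ncard) (Set.toFinite _) (by
      obtain ⟨X, hX⟩ := hC
      obtain ⟨n, hn⟩ := hVidem X
      exact ⟨_, hVpow X ⟨[X], by simp, by simpa using hX, by simp⟩ n, hn⟩)
  have hgroup : ∀ Y ∈ V, ∃ Z ∈ U, E ⊆ Z ∧ E * Y * E ⊆ Z := by
    intro Y hY
    set Z := E * Y * E with hZ
    have hZV : Z ∈ V := hVmul _ (hVmul _ hEV _ hY) _ hEV
    have hEZ : E * Z = Z := by rw [hZ, ← mul_assoc, ← mul_assoc, hEE]
    have hZE : Z * E = Z := by rw [hZ, mul_assoc, hEE]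
    obtain ⟨n, hn⟩ := hVidem Z
    set G := Z ^ (n + 1) with hG
    have hEG : E * G = G := by rw [hG, pow_succ', ← mul_assoc, hEZ]
    have hGE : G * E = G := by rw [hG, pow_succ, mul_assoc, hZE]
    have hsub : corner G ⊆ corner E := by
      rintro _ ⟨Y', hY', rfl⟩
      refine ⟨G * Y' * G, hVmul _ (hVmul _ (hVpow Z hZV n) _ hY') _ (hVpow Z hZV n), ?_⟩
      rw [mul_assoc E, mul_assoc (G * Y'), hGE, ← mul_assoc, ← mul_assoc, hEG]
    have heq := Set.eq_of_subset_of_ncard_le hsub (hmin G ⟨hVpow Z hZV n, hn⟩) (Set.toFinite _)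
    have hE : E ∈ corner G := by
      rw [heq]
      exact ⟨E, hEV, by rw [hEE, hEE]⟩
    obtain ⟨Y', -, hE'⟩ := hE
    have hGeq : G = E := by
      rw [← hGE]
      conv_lhs => rw [hE']
      rw [← mul_assoc, ← mul_assoc, hn, ← hE']
    refine ⟨_, hU.tail_mem Z (hVU Z hZV) (n + 1) (n + 1) (by omega) (by omega)
      (by rw [pow_add Z (n + 1), ← hG, hn]), fun x hx => ⟨n + 1, le_rfl, ?_⟩,
      fun x hx => ⟨n + 2, by omega, ?_⟩⟩
    · rw [← hG, hGeq]
      exact hx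
    · rw [pow_succ, ← hG, hGeq, hEZ]
      exact hx
  have hcover : ∀ s : Set (Set M), s ⊆ V → ∃ W ∈ U, E ⊆ W ∧ ∀ Y ∈ s, E * Y * E ⊆ W := by
    intro s
    induction s, Set.toFinite s using Set.Finite.induction_on with
    | empty => exact fun _ => ⟨E, hVU E hEV, le_rfl, by simp⟩
    | @insert Y s _ _ ih =>
      intro hs
      obtain ⟨W, hW, hEW, h⟩ := ih fun Z hZ => hs (Set.mem_insert_of_mem _ hZ)
      obtain ⟨Z, hZ, hEZ, hYZ⟩ := hgroup Y (hs (Set.mem_insert _ _))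
      refine ⟨W * Z, hU.mul_mem _ hW _ hZ, ?_, ?_⟩
      · have := Set.mul_subset_mul hEW hEZ
        rwa [hEE] at this
      · intro T hT
        rcases hT with rfl | hT
        · have := Set.mul_subset_mul hEW hYZ
          rwa [← mul_assoc, ← mul_assoc, hEE] at this
        · have := Set.mul_subset_mul (h T hT) hEZ
          rwa [mul_assoc, hEE] at this
  obtain ⟨W, hW, -, h⟩ := hcover V le_rfl
  refine hU.downward W hW _ fun x hx => ?_
  rw [← hVr E hEV, ← hVl E hEV] at hx
  obtain ⟨_, ⟨e, he, y, ⟨w, hw, hwC, hy⟩, rfl⟩, e', he', rfl⟩ := hx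
  exact h w.prod ⟨w, hw, hwC, rfl⟩ (Set.mul_mem_mul (Set.mul_mem_mul he hy) he')

/-! ### Merging a letter with the other letters -/

theorem prod_unblock {P : Type u} [Monoid P] (a : P)
    (d : List P × List (List P × List P) × List P) :
    (unblock a d).prod =
      d.1.prod * (d.2.1.map fun p => p.1.prod * a * p.2.prod).prod * d.2.2.prod := by
  obtain ⟨c₀, L, b⟩ := d
  have h : (L.flatMap fun p => p.1 ++ a :: p.2).prod =
      (L.map fun p => p.1.prod * a * p.2.prod).prod := by
    induction L with
    | nil => rfl
    | cons p L ih => simp [ih, mul_assoc]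
  simp [unblock, h, mul_assoc]

theorem prod_map_subset {B : Type u} {f g : B → Set M} (h : ∀ p, f p ⊆ g p) (L : List B) :
    (L.map f).prod ⊆ (L.map g).prod := by
  induction L with
  | nil => simp
  | cons p L ih =>
    simp only [List.map_cons, List.prod_cons]
    exact Set.mul_subset_mul (h p) ih

/-- Suppose that words in `X` alone and words in the other letters are settled at depth `k₂`, and
words in nonempty members of `U` contained in `X * spanOf C` at depth `k₃`. A word over `C` is
read as a word whose letters are its blocks `pᵢ X cᵢ`, each block being replaced by the subset
`classProd k₂ pᵢ * X * classProd k₂ cᵢ` of `X * spanOf C`. -/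
theorem classProd_mem_of_blocks (hU : IsClosedFamily U) {X : Set M} (hX : X ∈ C)
    (hC : ∀ Y ∈ C, Y ∈ U ∧ Y.Nonempty) {k₂ k₃ : ℕ}
    (h₁ : ∀ w : List (Set M), w ≠ [] → (∀ Y ∈ w, Y = X) → classProd k₂ w ∈ U)
    (h₂ : ∀ w : List (Set M), w ≠ [] → (∀ Y ∈ w, Y ∈ C ∧ Y ≠ X) → classProd k₂ w ∈ U)
    (h₃ : ∀ w : List (Set M), w ≠ [] → (∀ Y ∈ w, Y ∈ U ∧ Y ⊆ X * spanOf C ∧ Y.Nonempty) →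
      classProd k₃ w ∈ U)
    {w : List (Set M)} (hw : w ≠ []) (hwC : ∀ Y ∈ w, Y ∈ C) :
    classProd (k₂ + 2 + k₃) w ∈ U := by
  classical
  let g : List (Set M) × List (Set M) → Set M := fun p =>
    classProd k₂ p.1 * X * classProd k₂ p.2
  have hg : ∀ p p' c c', WordEqv k₂ p p' → WordEqv k₂ c c' → g (p, c) = g (p', c') := by
    intro p p' c c' hp hc
    simp only [g, classProd_congr hp, classProd_congr hc]
  have hsub : classProd (k₂ + 2 + k₃) w ⊆ classProd k₂ (blocks X w).1 *
      classProd k₃ ((blocks X w).2.1.map g) * classProd k₂ (blocks X w).2.2 := by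
    rintro x ⟨w', hw', hx⟩
    rw [← unblock_blocks (a := X) w', prod_unblock] at hx
    refine Set.mul_subset_mul (Set.mul_subset_mul ?_ ?_) ?_ hx
    · rw [← classProd_congr (hw'.mono (j := k₂ + 1) (by omega)).blocks_head]
      exact prod_subset_classProd _ _
    · rw [← classProd_congr (hw'.blocks_map (a := X) hg k₃)]
      refine (prod_map_subset (fun p => ?_) _).trans (prod_subset_classProd _ _)
      exact Set.mul_subset_mul (Set.mul_subset_mul (prod_subset_classProd _ _) le_rfl)
        (prod_subset_classProd _ _)
    · rw [← classProd_congr (hw'.mono (j := k₂ + 1) (by omega)).blocks_tail]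
      exact prod_subset_classProd _ _
  refine hU.downward _ ?_ _ hsub
  have hd := isBlockDecomposition_blocks (a := X) w
  have hw' := unblock_blocks (a := X) w
  generalize blocks X w = d at hd hw'
  obtain ⟨c₀, L, b⟩ := d
  have hc₀ : c₀ ≠ [] → classProd k₂ c₀ ∈ U := fun h => h₂ c₀ h fun Y hY =>
    ⟨hwC Y (by rw [← hw']; simp [unblock, hY]), fun h => hd.head (h ▸ hY)⟩
  have hb : b ≠ [] → classProd k₂ b ∈ U := fun h => h₁ b h hd.tail
  have hL : L.map g ≠ [] → classProd k₃ (L.map g) ∈ U := by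
    intro h
    refine h₃ _ h fun Y hY => ?_
    obtain ⟨⟨p, c⟩, hp, rfl⟩ := List.mem_map.1 hY
    have hpX := hd.left _ hp
    have hcne := hd.right_ne_nil _ hp
    have hcC : ∀ Y ∈ c, Y ∈ C := fun Y hY => hwC Y (by
      rw [← hw']
      simp only [unblock, List.mem_append, List.mem_flatMap]
      exact Or.inr (Or.inl ⟨_, hp, by simp [hY]⟩))
    have hcU : classProd k₂ c ∈ U := h₂ c hcne fun Y hY =>
      ⟨hcC Y hY, fun h => hd.right _ hp (h ▸ hY)⟩
    refine ⟨?_, ?_, ?_⟩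
    · by_cases hpn : p = []
      · simp only [g, hpn, classProd_nil, one_mul]
        exact hU.mul_mem _ (hC X hX).1 _ hcU
      · exact hU.mul_mem _ (hU.mul_mem _ (h₁ p hpn hpX) _ (hC X hX).1) _ hcU
    · rintro _ ⟨_, ⟨y, ⟨p', hp', hy⟩, x, hx, rfl⟩, z, ⟨c', hc', hz⟩, rfl⟩
      have hp'X : p' = List.replicate p'.length X :=
        List.eq_replicate_of_mem fun Y hY => hpX Y ((hp'.mem_iff Y).1 hY)
      have hcomm : p'.prod * X = X * p'.prod := by
        rw [hp'X, List.prod_replicate, pow_mul_comm']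
      have h4 : y * x * z ∈ p'.prod * X * c'.prod :=
        Set.mul_mem_mul (Set.mul_mem_mul hy hx) hz
      rw [hcomm, mul_assoc, ← List.prod_append] at h4
      refine Set.mul_subset_mul le_rfl (prod_subset_spanOf ?_ fun Y hY => ?_) h4
      · simp only [ne_eq, List.append_eq_nil_iff, not_and]
        exact fun _ h => hcne (hc'.eq_nil_iff.1 h)
      · rcases List.mem_append.1 hY with h | h
        · rw [hpX Y ((hp'.mem_iff Y).1 h)]
          exact hX
        · exact hcC Y ((hc'.mem_iff Y).1 h)
    · refine Set.Nonempty.mul (Set.Nonempty.mul ?_ (hC X hX).2) ?_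
      · refine (prod_nonempty fun Y hY => ?_).mono (prod_subset_classProd _ _)
        rw [hpX Y hY]
        exact (hC X hX).2
      · exact (prod_nonempty fun Y hY => (hC Y (hcC Y hY)).2).mono (prod_subset_classProd _ _)
  dsimp only
  by_cases e₁ : c₀ = [] <;> by_cases e₂ : L.map g = [] <;> by_cases e₃ : b = []
  · have e₂' : L = [] := List.map_eq_nil_iff.1 e₂
    subst e₁ e₂' e₃
    exact absurd hw'.symm hw
  · rw [e₁, e₂, classProd_nil, classProd_nil, one_mul, one_mul]
    exact hb e₃
  · rw [e₁, e₃, classProd_nil, one_mul, mul_one]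
    exact hL e₂
  · rw [e₁, classProd_nil, one_mul]
    exact hU.mul_mem _ (hL e₂) _ (hb e₃)
  · rw [e₂, e₃, classProd_nil, classProd_nil, mul_one, mul_one]
    exact hc₀ e₁
  · rw [e₂, classProd_nil, mul_one]
    exact hU.mul_mem _ (hc₀ e₁) _ (hb e₃)
  · rw [e₃, classProd_nil, mul_one]
    exact hU.mul_mem _ (hc₀ e₁) _ (hL e₂)
  · exact hU.mul_mem _ (hU.mul_mem _ (hc₀ e₁) _ (hL e₂)) _ (hb e₃)

end Families
/-! ### Reversing the multiplication -/

/-- The opposite multiplication, on the same carrier so that subsets are kept as they are. -/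
abbrev reverseMonoid (M : Type u) [Monoid M] : Monoid M where
  mul a b := b * a
  mul_assoc a b c := (mul_assoc c b a).symm
  one := 1
  one_mul := mul_one
  mul_one := one_mul
  npow n a := a ^ n
  npow_zero := pow_zero
  npow_succ n a := pow_succ' a n

section Reverse

variable {M : Type u} [i : Monoid M] {U : Set (Set M)} {C : Finset (Set M)} {k : ℕ}

theorem reverse_mul (X Y : Set M) :
    (@Set.mul M (reverseMonoid M).toMul).mul X Y = Y * X := by
  ext z
  constructor
  · rintro ⟨x, hx, y, hy, rfl⟩
    exact ⟨y, hy, x, hx, rfl⟩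
  · rintro ⟨y, hy, x, hx, rfl⟩
    exact ⟨x, hx, y, hy, rfl⟩

theorem reverse_prod (w : List (Set M)) :
    @List.prod (Set M) (@Set.mul M (reverseMonoid M).toMul) (@Set.one M (reverseMonoid M).toOne) w =
      w.reverse.prod := by
  induction w with
  | nil => rfl
  | cons X w ih =>
    rw [List.reverse_cons, List.prod_append, List.prod_singleton, ← ih]
    exact reverse_mul X _

theorem reverse_pow (X : Set M) (n : ℕ) :
    (@Set.monoid M (reverseMonoid M)).npow n X = X ^ n := by
  induction n with
  | zero => exact (@Set.monoid M (reverseMonoid M)).npow_zero X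
  | succ n ih =>
    refine ((@Set.monoid M (reverseMonoid M)).npow_succ n X).trans ?_
    exact (reverse_mul _ X).trans ((congrArg (X * ·) ih).trans (pow_succ' X n).symm)

theorem IsClosedFamily.reverse (hU : IsClosedFamily U) : @IsClosedFamily M (reverseMonoid M) U :=
  @IsClosedFamily.mk M (reverseMonoid M) U
    (fun X hX Y hY => by
      have h := hU.mul_mem Y hY X hX
      rw [← reverse_mul X Y] at h
      exact h) hU.downward
    (fun X hX N p hN hp h => by
      have h' : X ^ N = X ^ (N + p) :=
        (reverse_pow X N).symm.trans (h.trans (reverse_pow X (N + p)))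
      have := hU.tail_mem X hX N p hN hp h'
      refine hU.downward _ this _ ?_
      rintro x ⟨j, hj, hx⟩
      exact ⟨j, hj, (reverse_pow X j) ▸ hx⟩)

theorem classProd_reverse (w : List (Set M)) :
    @classProd M (reverseMonoid M) k w = classProd k w.reverse := by
  ext x
  constructor
  · rintro ⟨w', hw', hx⟩
    exact ⟨w'.reverse, hw'.reverse, (reverse_prod w') ▸ hx⟩
  · rintro ⟨w', hw', hx⟩
    refine ⟨w'.reverse, by simpa using hw'.reverse, (reverse_prod w'.reverse).symm ▸ ?_⟩
    rwa [List.reverse_reverse]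

theorem spanOf_reverse : @spanOf M (reverseMonoid M) C = spanOf C := by
  ext x
  constructor
  · rintro ⟨w, hw, hC, hx⟩
    exact ⟨w.reverse, by simpa using hw, by simpa using hC, (reverse_prod w) ▸ hx⟩
  · rintro ⟨w, hw, hC, hx⟩
    refine ⟨w.reverse, by simpa using hw, by simpa using hC, (reverse_prod w.reverse).symm ▸ ?_⟩
    rwa [List.reverse_reverse]

/-- The mirror image of `classProd_mem_of_blocks`, with blocks `cᵢ X pᵢ`. -/
theorem classProd_mem_of_blocks_reverse (hU : IsClosedFamily U) {X : Set M} (hX : X ∈ C)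
    (hC : ∀ Y ∈ C, Y ∈ U ∧ Y.Nonempty) {k₂ k₃ : ℕ}
    (h₁ : ∀ w : List (Set M), w ≠ [] → (∀ Y ∈ w, Y = X) → classProd k₂ w ∈ U)
    (h₂ : ∀ w : List (Set M), w ≠ [] → (∀ Y ∈ w, Y ∈ C ∧ Y ≠ X) → classProd k₂ w ∈ U)
    (h₃ : ∀ w : List (Set M), w ≠ [] → (∀ Y ∈ w, Y ∈ U ∧ Y ⊆ spanOf C * X ∧ Y.Nonempty) →
      classProd k₃ w ∈ U)
    {w : List (Set M)} (hw : w ≠ []) (hwC : ∀ Y ∈ w, Y ∈ C) :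
    classProd (k₂ + 2 + k₃) w ∈ U := by
  have h := @classProd_mem_of_blocks M (reverseMonoid M) U C hU.reverse X hX hC k₂ k₃
    (fun w hw h => by
      rw [classProd_reverse]
      exact h₁ _ (by simpa using hw) (by simpa using h))
    (fun w hw h => by
      rw [classProd_reverse]
      exact h₂ _ (by simpa using hw) fun Y hY => h Y (by simpa using hY))
    (fun w hw h => by
      rw [classProd_reverse]
      refine h₃ _ (by simpa using hw) fun Y hY => ?_
      obtain ⟨h4, h5, h6⟩ := h Y (by simpa using hY)
      rw [spanOf_reverse] at h5
      exact ⟨h4, h5.trans (reverse_mul X _).le, h6⟩)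
    w.reverse (by simpa using hw) (by simpa using hwC)
  rwa [classProd_reverse, List.reverse_reverse] at h

end Reverse

/-! ### The depth bound -/

theorem le_choose_two_succ (r : ℕ) : r ≤ r.choose 2 + 1 := by
  induction r with
  | zero => omega
  | succ r ih =>
    rw [Nat.choose_succ_succ' r 1, Nat.choose_one_right]
    omega

/-- With `n = r + 1`, the depth for `m + 2` letters is reached from the depth for `m + 1` letters and
the depth for the at most `2 ^ r - 1` nonempty subsets of a set of size `r`, since
`2 ^ (r + 1).choose 2 = 2 ^ r * 2 ^ r.choose 2`. All depths are one less than the exponents of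
`SLPow`, as depth `k` belongs to `SLPow (k + 1)`. -/
theorem depth_add_le (m r : ℕ) (hr : 1 ≤ r) :
    (m * 2 ^ (r + 1).choose 2 + 2 ^ (r + 1) - 2) + 2 +
      ((2 ^ r - 2) * 2 ^ r.choose 2 + 2 ^ r - 2) ≤
        (m + 1) * 2 ^ (r + 1).choose 2 + 2 ^ (r + 1) - 2 := by
  have h1 : 2 ^ (r + 1).choose 2 = 2 ^ r * 2 ^ r.choose 2 := by
    rw [Nat.choose_succ_succ' r 1, Nat.choose_one_right, pow_add]
  have h2 : 2 ^ r ≤ 2 ^ r.choose 2 * 2 := by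
    rw [← pow_succ]
    exact Nat.pow_le_pow_right (by omega) (le_choose_two_succ r)
  have h3 : 2 ≤ 2 ^ r := by
    calc 2 = 2 ^ 1 := rfl
      _ ≤ 2 ^ r := Nat.pow_le_pow_right (by omega) hr
  have h4 : 2 ≤ 2 ^ (r + 1) := by rw [pow_succ]; omega
  obtain ⟨s, hs⟩ := Nat.exists_eq_add_of_le h3
  rw [h1]
  generalize 2 ^ r.choose 2 = q at *
  generalize 2 ^ (r + 1) = z at *
  rw [hs] at h2 ⊢
  rw [show 2 + s - 2 = s by omega, show s * q + (2 + s) - 2 = s * q + s by omega]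
  have h5 : (m + 1) * ((2 + s) * q) = m * ((2 + s) * q) + (2 * q + s * q) := by ring
  rw [h5]
  generalize m * ((2 + s) * q) = y
  omega

section Main

variable {M : Type u} [Monoid M] [Finite M] {U : Set (Set M)}

/-- The depth `m * 2 ^ n.choose 2 + 2 ^ n - 2` settles the words in at most `m + 1` letters spanning
a subsemigroup of size at most `n`. -/
theorem classProd_mem (hU : IsClosedFamily U) (n : ℕ) :
    ∀ (m : ℕ) (C : Finset (Set M)), C.card ≤ m + 1 → (∀ X ∈ C, X ∈ U ∧ X.Nonempty) →
      (spanOf C).ncard ≤ n → ∀ k, m * 2 ^ n.choose 2 + 2 ^ n - 2 ≤ k →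
      ∀ w : List (Set M), w ≠ [] → (∀ X ∈ w, X ∈ C) → classProd k w ∈ U := by
  induction n with
  | zero =>
    intro m C _ hC hn k _ w hw hwC
    -- the span of a nonempty set of nonempty letters is not empty
    have h1 := (prod_nonempty fun X hX => (hC X (hwC X hX)).2).mono (prod_subset_spanOf hw hwC)
    rw [← Set.ncard_pos (Set.toFinite _)] at h1
    omega
  | succ r ihr =>
    intro m
    induction m with
    | zero =>
      intro C hm hC hn k hk w hw hwC
      obtain ⟨X, hX⟩ := List.exists_mem_of_ne_nil w hw
      have hXC := hwC X hX
      refine classProd_mem_of_single hU (hC X hXC).1 (hC X hXC).2 (subset_spanOf hXC)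
        (spanOf_mul_subset C) hn (by omega) hw fun Y hY => ?_
      exact Finset.card_le_one.1 hm Y (hwC Y hY) X hXC
    | succ m ihm =>
      intro C hm hC hn k hk w hw hwC
      have h₁ : ∀ X ∈ C, ∀ w : List (Set M), w ≠ [] → (∀ Y ∈ w, Y = X) →
          classProd (m * 2 ^ (r + 1).choose 2 + 2 ^ (r + 1) - 2) w ∈ U := by
        intro X hX w hw hwX
        refine classProd_mem_of_single hU (hC X hX).1 (hC X hX).2 (subset_spanOf hX)
          (spanOf_mul_subset C) hn (by omega) hw hwX
      have h₂ : ∀ X ∈ C, ∀ w : List (Set M), w ≠ [] → (∀ Y ∈ w, Y ∈ C ∧ Y ≠ X) →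
          classProd (m * 2 ^ (r + 1).choose 2 + 2 ^ (r + 1) - 2) w ∈ U := by
        classical
        intro X hX w hw hwX
        refine ihm (C.erase X) ?_ (fun Y hY => hC Y (Finset.mem_of_mem_erase hY)) ?_ _ le_rfl w hw
          fun Y hY => Finset.mem_erase.2 ⟨(hwX Y hY).2, (hwX Y hY).1⟩
        · rw [Finset.card_erase_of_mem hX]
          omega
        · exact (Set.ncard_le_ncard (spanOf_mono (Finset.erase_subset X C)) (Set.toFinite _)).trans hn
      have h₃ : ∀ R : Set M, R * R ⊆ R → R ⊆ spanOf C → R ≠ spanOf C → R.Nonempty → 1 ≤ r ∧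
          ∀ w : List (Set M), w ≠ [] → (∀ Y ∈ w, Y ∈ U ∧ Y ⊆ R ∧ Y.Nonempty) →
            classProd ((2 ^ r - 2) * 2 ^ r.choose 2 + 2 ^ r - 2) w ∈ U := by
        intro R hRR hRC hne hR
        have hcard : R.ncard ≤ r := by
          have := Set.ncard_lt_ncard (hRC.ssubset_of_ne hne) (Set.toFinite _)
          omega
        have hpos := (Set.ncard_pos (Set.toFinite R)).2 hR
        refine ⟨by omega, fun w hw hwR => ?_⟩
        let C' : Finset (Set M) := (Set.toFinite {Y : Set M | Y ∈ U ∧ Y ⊆ R ∧ Y.Nonempty}).toFinset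
        have hC' : ∀ Y, Y ∈ C' ↔ Y ∈ U ∧ Y ⊆ R ∧ Y.Nonempty := fun Y =>
          Set.Finite.mem_toFinset _
        refine ihr (2 ^ r - 2) C' ?_ (fun Y hY => ?_) ?_ _ le_rfl w hw
          fun Y hY => (hC' Y).2 (hwR Y hY)
        · rw [← Set.ncard_eq_toFinset_card]
          have h4 : {Y : Set M | Y ∈ U ∧ Y ⊆ R ∧ Y.Nonempty}.ncard ≤ _ :=
            Set.ncard_le_ncard (fun Y hY => hY.2) (Set.toFinite _)
          have h5 := h4.trans (ncard_nonempty_subsets_le hcard)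
          have h6 : 2 ^ 1 ≤ 2 ^ r := Nat.pow_le_pow_right (by omega) (by omega)
          omega
        · exact ⟨((hC' Y).1 hY).1, ((hC' Y).1 hY).2.2⟩
        · refine (Set.ncard_le_ncard (spanOf_subset hRR fun Y hY => ?_) (Set.toFinite _)).trans hcard
          exact ((hC' Y).1 hY).2.1
      have hne : (spanOf C).Nonempty :=
        (prod_nonempty fun X hX => (hC X (hwC X hX)).2).mono (prod_subset_spanOf hw hwC)
      by_cases hl : ∀ X ∈ C, X * spanOf C = spanOf C
      · by_cases hr : ∀ X ∈ C, spanOf C * X = spanOf C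
        · obtain ⟨X, hX⟩ := List.exists_mem_of_ne_nil w hw
          exact hU.downward _ (spanOf_mem hU (fun X hX => (hC X hX).1) ⟨X, hwC X hX⟩ hl hr) _
            (classProd_subset_spanOf hw hwC)
        · push Not at hr
          obtain ⟨X, hX, hXne⟩ := hr
          have hsub : spanOf C * X ⊆ spanOf C :=
            (Set.mul_subset_mul le_rfl (subset_spanOf hX)).trans (spanOf_mul_subset C)
          obtain ⟨hr1, h₃'⟩ := h₃ (spanOf C * X) (by
            rw [← mul_assoc]
            refine Set.mul_subset_mul ?_ le_rfl
            exact (Set.mul_subset_mul hsub le_rfl).trans (spanOf_mul_subset C))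
            hsub hXne (hne.mul (hC X hX).2)
          exact hU.downward _
            (classProd_mem_of_blocks_reverse hU hX hC (h₁ X hX) (h₂ X hX) h₃' hw hwC) _
            (classProd_anti ((depth_add_le m r hr1).trans hk) w)
      · push Not at hl
        obtain ⟨X, hX, hXne⟩ := hl
        have hsub : X * spanOf C ⊆ spanOf C :=
          (Set.mul_subset_mul (subset_spanOf hX) le_rfl).trans (spanOf_mul_subset C)
        obtain ⟨hr1, h₃'⟩ := h₃ (X * spanOf C) (by
          rw [mul_assoc]
          refine Set.mul_subset_mul le_rfl ?_
          exact (Set.mul_subset_mul le_rfl hsub).trans (spanOf_mul_subset C))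
          hsub hXne ((hC X hX).2.mul hne)
        exact hU.downward _
          (classProd_mem_of_blocks hU hX hC (h₁ X hX) (h₂ X hX) h₃' hw hwC) _
          (classProd_anti ((depth_add_le m r hr1).trans hk) w)

end Main

/-! ### Pointlike sets and saturation -/

theorem isSaturated_saturation {S : Type u} [Semigroup S] [Finite S] (U : Set (Set S)) :
    IsSaturated (saturation U) where
  mul_mem _ hX _ hY V hV := hV.2.mul_mem _ (hX V hV) _ (hY V hV)
  downward _ hX Y hY V hV := hV.2.downward _ (hX V hV) Y hY
  omegaStar_mem _ hX V hV := hV.2.omegaStar_mem _ (hX V hV)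

theorem image_coe_mul {S : Type u} [Semigroup S] (X Y : Set S) :
    ((fun s : S => (s : WithOne S)) '' (X * Y)) =
      ((fun s : S => (s : WithOne S)) '' X) * ((fun s : S => (s : WithOne S)) '' Y) :=
  Set.image_mul (WithOne.coeMulHom (α := S))

theorem image_coe_sgPow {S : Type u} [Semigroup S] (X : Set S) (n : ℕ) :
    ((fun s : S => (s : WithOne S)) '' (sgPow X n)) =
      ((fun s : S => (s : WithOne S)) '' X) ^ (n + 1) := by
  induction n with
  | zero => simp [sgPow]
  | succ n ih =>
    rw [pow_succ, ← ih, ← image_coe_mul]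
    rfl

/-- In the periodic range, `X ^ i = X ^ ω * X ^ i`. -/
theorem sgPow_subset_omegaStar {S : Type u} [Semigroup S] [Finite S] (X : Set S) {N p : ℕ}
    (hp : 0 < p) (h : sgPow X N = sgPow X (N + p)) {i : ℕ} (hi : N ≤ i) :
    sgPow X i ⊆ omegaStar X := by
  have hper : ∀ t j, N ≤ j → sgPow X j = sgPow X (j + t * p) := by
    intro t
    induction t with
    | zero => simp
    | succ t ih =>
      intro j hj
      have h1 : sgPow X j = sgPow X (j + p) := by
        rcases hj.eq_or_lt with rfl | hlt
        · exact h
        · obtain ⟨d, rfl⟩ : ∃ d, j = d + N + 1 := ⟨j - N - 1, by omega⟩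
          rw [← sgPow_mul_sgPow, h, sgPow_mul_sgPow]
          congr 1
          omega
      rw [h1, ih (j + p) (by omega)]
      congr 1
      ring
  obtain ⟨m, hm⟩ := exists_omegaPow_eq X
  have h2 : sgPow X i = omegaPow X * sgPow X i := by
    have h3 := sgPow_of_idempotent (omegaPow_idempotent X) (p - 1)
    rw [hm, sgPow_sgPow, ← hm, Nat.sub_add_cancel hp] at h3
    rw [← h3, sgPow_mul_sgPow, hper (m + 1) i hi]
    congr 1
    have : 0 < (m + 1) * p := by positivity
    omega
  rw [h2]
  exact Set.subset_union_of_subset_right (Set.subset_iUnion (fun n => omegaPow X * sgPow X n) i) _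

theorem isClosedFamily_image {S : Type u} [Semigroup S] [Finite S] {V : Set (Set S)}
    (hV : IsSaturated V) :
    IsClosedFamily {Y : Set (WithOne S) | ∃ X ∈ V, (fun s : S => (s : WithOne S)) '' X = Y} where
  mul_mem := by
    rintro _ ⟨X, hX, rfl⟩ _ ⟨Y, hY, rfl⟩
    exact ⟨X * Y, hV.mul_mem X hX Y hY, image_coe_mul X Y⟩
  downward := by
    rintro _ ⟨X, hX, rfl⟩ Y hY
    obtain ⟨Z, hZ, rfl⟩ := Set.subset_image_iff.1 hY
    exact ⟨Z, hV.downward X hX Z hZ, rfl⟩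
  tail_mem := by
    rintro _ ⟨X, hX, rfl⟩ N p hN hp h
    obtain ⟨N, rfl⟩ : ∃ N', N = N' + 1 := ⟨N - 1, by omega⟩
    rw [show N + 1 + p = (N + p) + 1 by omega, ← image_coe_sgPow, ← image_coe_sgPow] at h
    have h' := Set.image_injective.2 (WithOne.coe_injective (α := S)) h
    refine ⟨⋃ i : ℕ, sgPow X (N + i), hV.downward _ (hV.omegaStar_mem X hX) _
      (Set.iUnion_subset fun i => sgPow_subset_omegaStar X hp h' (by omega)), ?_⟩
    ext x
    simp only [Set.image_iUnion, image_coe_sgPow, Set.mem_iUnion, Set.mem_ofPred_eq]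
    constructor
    · rintro ⟨i, hi⟩
      exact ⟨_, by omega, hi⟩
    · rintro ⟨i, hi, hx⟩
      exact ⟨i - (N + 1), by rwa [show N + (i - (N + 1)) + 1 = i by omega]⟩

theorem exists_word_of_closure {S : Type u} [Semigroup S] {A : Set S}
    (hA : Subsemigroup.closure A = ⊤) (s : S) :
    ∃ w : List (Set (WithOne S)), w ≠ [] ∧ (∀ X ∈ w, ∃ a ∈ A, X = {(a : WithOne S)}) ∧
      w.prod = {(s : WithOne S)} := by
  have hs : s ∈ Subsemigroup.closure A := by rw [hA]; trivial
  induction hs using Subsemigroup.closure_induction with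
  | mem a ha => exact ⟨[{(a : WithOne S)}], by simp, by simpa using ha, by simp⟩
  | mul x y _ _ hx hy =>
    obtain ⟨u, hu, huA, hux⟩ := hx
    obtain ⟨v, hv, hvA, hvy⟩ := hy
    refine ⟨u ++ v, by simp [hu], fun X hX => (List.mem_append.1 hX).elim (huA X) (hvA X), ?_⟩
    rw [List.prod_append, hux, hvy, Set.singleton_mul_singleton, WithOne.coe_mul]

/-- A set that is pointlike for the relational morphism taking `s` to the classes of the words with
product `s` is covered by the products of the words in one class. -/
theorem PL_slPow_subset_saturation {S : Type u} [Semigroup S] [Finite S] [Nonempty S] {A : Set S}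
    (hA : Subsemigroup.closure A = ⊤) {k : ℕ}
    (hk : (A.ncard - 1) * 2 ^ (Nat.card S).choose 2 + 2 ^ Nat.card S - 2 ≤ k) :
    PL (SLPow (k + 1)) S ⊆ saturation (Set.range fun s : S => ({s} : Set S)) := by
  classical
  intro X hX
  rcases X.eq_empty_or_nonempty with rfl | ⟨s₀, hs₀⟩
  · exact fun V hV => hV.2.downward _ (hV.1 ⟨Classical.arbitrary S, rfl⟩) _ (Set.empty_subset _)
  have : Finite (WithOne S) := inferInstanceAs (Finite (Option S))
  have hsat := isSaturated_saturation (Set.range fun s : S => ({s} : Set S))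
  have hU := isClosedFamily_image hsat
  let C : Finset (Set (WithOne S)) :=
    (Set.toFinite ((fun a : S => ({(a : WithOne S)} : Set (WithOne S))) '' A)).toFinset
  have hC : ∀ Y, Y ∈ C ↔ ∃ a ∈ A, Y = {(a : WithOne S)} := by
    intro Y
    simp [C, eq_comm]
  obtain ⟨Q, _, _, f, hQ, hf, hfe⟩ := exists_slPow_recognizing (Set (WithOne S)) k
  let ρ : RelMorphism S Q :=
    { rel := fun s => {t | ∃ w : List (Set (WithOne S)), w ≠ [] ∧ (∀ Y ∈ w, Y ∈ C) ∧
        w.prod = {(s : WithOne S)} ∧ f w = t}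
      nonempty := fun s => by
        obtain ⟨w, hw, hwA, hws⟩ := exists_word_of_closure hA s
        exact ⟨f w, w, hw, fun Y hY => (hC Y).2 (hwA Y hY), hws, rfl⟩
      mul_subset := by
        rintro s s' _ ⟨_, ⟨w, hw, hwC, hws, rfl⟩, _, ⟨w', hw', hwC', hws', rfl⟩, rfl⟩
        refine ⟨w ++ w', by simp [hw], fun Y hY => (List.mem_append.1 hY).elim (hwC Y) (hwC' Y), ?_,
          hf w w'⟩
        rw [List.prod_append, hws, hws', Set.singleton_mul_singleton, WithOne.coe_mul] }
  obtain ⟨t, ht⟩ := hX Q hQ ρ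
  obtain ⟨w₀, hw₀, hwC₀, -, hwt₀⟩ := ht hs₀
  have hmem := classProd_mem hU (Nat.card S) (A.ncard - 1) C (by
      have h1 : C.card ≤ A.ncard := by
        rw [← Set.ncard_eq_toFinset_card]
        exact Set.ncard_image_le (Set.toFinite A)
      omega) (fun Y hY => by
      obtain ⟨a, -, rfl⟩ := (hC Y).1 hY
      refine ⟨⟨{a}, fun V hV => hV.1 ⟨a, rfl⟩, by simp⟩, Set.singleton_nonempty _⟩) (by
      have h1 : spanOf C ⊆ Set.range fun s : S => (s : WithOne S) := by
        refine spanOf_subset ?_ fun Y hY => ?_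
        · rintro _ ⟨_, ⟨x, rfl⟩, _, ⟨y, rfl⟩, rfl⟩
          exact ⟨x * y, WithOne.coe_mul x y⟩
        · obtain ⟨a, -, rfl⟩ := (hC Y).1 hY
          simp
      refine (Set.ncard_le_ncard h1 (Set.toFinite _)).trans ?_
      rw [← Set.image_univ, ← Set.ncard_univ]
      exact Set.ncard_image_le (Set.toFinite _)) k hk w₀ hw₀ hwC₀
  obtain ⟨Z, hZ, hZw⟩ := hmem
  refine hsat.downward Z hZ X fun s hs => ?_
  obtain ⟨w, -, -, hws, hwt⟩ := ht hs
  have h1 : (s : WithOne S) ∈ classProd k w₀ :=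
    ⟨w, hfe _ _ (hwt.trans hwt₀.symm), by rw [hws]; rfl⟩
  rw [← hZw] at h1
  obtain ⟨s', hs', he⟩ := h1
  rwa [← WithOne.coe_injective he]

end Pointlike

theorem theorem3p2 {S : Type u} [Semigroup S] [Finite S] [Nonempty S] :
    Pointlike.PL Pointlike.Aperiodics S =
        Pointlike.saturation (Set.range fun s : S => ({s} : Set S)) ∧
      ∀ A : Set S, Subsemigroup.closure A = ⊤ →
        Pointlike.PL Pointlike.Aperiodics S =
          Pointlike.PL
            (Pointlike.SLPow
              ((A.ncard - 1) * 2 ^ (Nat.card S).choose 2 + 2 ^ Nat.card S - 1)) S := by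
  have hle := Pointlike.saturation_subset_PL_aperiodics S
  have hPL : ∀ k, Pointlike.PL Pointlike.Aperiodics S ⊆ Pointlike.PL (Pointlike.SLPow k) S :=
    fun k => Pointlike.PL_anti (Pointlike.aperiodics_of_slPow k) S
  refine ⟨(hPL _ |>.trans (Pointlike.PL_slPow_subset_saturation (A := Set.univ)
    Subsemigroup.closure_univ le_rfl)).antisymm hle, fun A hA => (hPL _).antisymm ?_⟩
  refine Set.Subset.trans ?_ hle
  have h1 : 2 ^ 1 ≤ 2 ^ Nat.card S := Nat.pow_le_pow_right (by omega) Nat.card_pos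
  obtain ⟨k, hk⟩ : ∃ k, (A.ncard - 1) * 2 ^ (Nat.card S).choose 2 + 2 ^ Nat.card S - 1 = k + 1 :=
    ⟨_, (Nat.sub_add_cancel (n := _) (m := 1) (by omega)).symm⟩
  rw [hk]
  exact Pointlike.PL_slPow_subset_saturation hA (by omega)
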